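/- **Conventions.** Graphs are finite multigraphs with coloured edges of three types: halvable, undirected and directed. Every edge consists of two half-edges, one at each end; in quotients an edge may also be a loop, or a single half-edge with a free end (called a *half-edge* of the quotient). Isomorphisms are bijections of vertices and half-edges that preserve incidence, edges, colours, edge types and directions. A group $\Gamma\le\mathrm{Aut}(G)$ is *semiregular* if no non-identity element of $\Gamma$ fixes a vertex or a half-edge, and only halvable edges may have their two half-edges transposed by an element of $\Gamma$. The quotient $G/\Gamma$ has the $\Gamma$-orbits of vertices and of half-edges as its vertices and half-edges, with colours, types and directions preserved; an edge whose two half-edges lie in one orbit becomes a half-edge of $G/\Gamma$. **Atoms.** Let $G$ be a connected graph without loops and half-edges, whose block-tree is rooted at a fixed block or articulation, the *centre*. The *parts* of $G$ are: (i) *block parts*: the subgraphs, other than a pendant edge, induced by the blocks of a rooted subtree of the block-tree whose root is not the centre; (ii) *proper parts*: for a block $B$ and two vertices $u,v$ of degree at least $3$ in $B$ such that $B\setminus\{u,v\}$ is disconnected, a connected component $K$ of $G\setminus\{u,v\}$ that meets $B$, together with $u$, $v$ and all edges between $K$ and $\{u,v\}$, provided that it does not contain the centre; (iii) *dipoles*: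 the subgraphs induced by two distinct vertices of degree at least $3$ joined by at least two parallel edges. The inclusion-minimal parts are the *atoms*; an atom that is both a block part and a dipole counts as a dipole. The boundary $\partial A$ of a dipole $A$ consists of its two vertices, and the boundary of any other atom $A$ of the vertices of $A$ incident with an edge outside of $A$. The remaining vertices and all edges of $A$ form its interior. Atoms are isomorphic if there is an isomorphism that maps boundary to boundary. A proper atom or dipole $A$ with $\partial A=\{u,v\}$ is *halvable* if some semiregular involution of $A$ exchanges $u$ and $v$ (semiregular meaning that it generates a semiregular group), *symmetric* if it is not halvable but some automorphism of $A$ exchanges $u$ and $v$, and *asymmetric* otherwise. **Reduction series.** Let $G_0$ be a finite connected graph without loops and half-edges, and let the centre be the central block or central articulation of $G_0$, which is kept as the centre in all steps. The graph $G_{i+1}$ arises from $G_i$ by replacing the interior of each atom $A$ by one new edge: a block atom with $\partial A=\{u\}$ by an undirected pendant edge at $u$, and a halvable, symmetric or asymmetric proper atom or dipole with $\partial A=\{u,v\}$ by a halvable, undirected or directed edge $uv$, respectively. New edges get colours not used in $G_i$, two of them getting the same colour exactly if they replace isomorphic atoms; the directions are chosen consistently with all isomorphisms between asymmetric atoms.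 The series $G_0,\dots,G_r$ stops as soon as $G_r$ has no atoms. An automorphism $\pi$ of $G_i$ induces the automorphism $\Phi_i(\pi)$ of $G_{i+1}$ that equals $\pi$ on the common vertices and edges and maps the half-edge at the end $x$ of the edge replacing $A$ to the half-edge at the end $\pi(x)$ of the edge replacing $\pi(A)$. For semiregular groups $\Gamma_i\le\mathrm{Aut}(G_i)$ and $\Gamma_{i+1}\le\mathrm{Aut}(G_{i+1})$, the group $\Gamma_i$ *extends* $\Gamma_{i+1}$ if $\Phi_i(\Gamma_i)=\Gamma_{i+1}$. Then $H_i=G_i/\Gamma_i$ is called an *expansion* of $H_{i+1}=G_{i+1}/\Gamma_{i+1}$. **Corollary.** Let $G_0,\dots,G_r$ be a reduction series. 1. Let $0\le i<r$, let $\Gamma_{i+1}\le\mathrm{Aut}(G_{i+1})$ be semiregular, and suppose that $H_{i+1}=G_{i+1}/\Gamma_{i+1}$ contains no half-edge. Then the expansion $H_i$ of $H_{i+1}$ is uniquely determined. That is, some semiregular $\Gamma_i\le\mathrm{Aut}(G_i)$ extends $\Gamma_{i+1}$; and whenever $\Gamma_i$ extends $\Gamma_{i+1}$, $\Gamma_i'$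 extends a semiregular group $\Gamma_{i+1}'\le\mathrm{Aut}(G_{i+1})$, and $\psi: G_{i+1}/\Gamma_{i+1}\to G_{i+1}/\Gamma'_{i+1}$ is an isomorphism, there is an isomorphism $\varphi: G_i/\Gamma_i\to G_i/\Gamma_i'$ that agrees with $\psi$ on the vertices and edges common to $H_i$ and $H_{i+1}$. (In particular, for $\Gamma_{i+1}'=\Gamma_{i+1}$ and $\psi=\mathrm{id}$, any two expansions of $H_{i+1}$ are isomorphic by an isomorphism that fixes all vertices and edges common with $H_{i+1}$.) 2. Let $\Gamma_r\le\mathrm{Aut}(G_r)$ be a semiregular group of odd order. Then $H_r=G_r/\Gamma_r$ uniquely determines $H_0$. That is, there are semiregular groups $\Gamma_{r-1},\dots,\Gamma_0$ such that $\Gamma_i$ extends $\Gamma_{i+1}$ for all $i<r$; and for any such series, any other series of semiregular groups $\Gamma'_r,\dots,\Gamma'_0$ such that $\Gamma'_i$ extends $\Gamma'_{i+1}$ for all $i<r$, and any isomorphism $\psi: G_r/\Gamma_r\to G_r/\Gamma_r'$, there are isomorphisms $\varphi_i: G_i/\Gamma_i\to G_i/\Gamma'_i$ for $0\le i\le r$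 such that $\varphi_r=\psi$ and $\varphi_i$ agrees with $\varphi_{i+1}$ on the common vertices and edges for all $i<r$. In particular $G_0/\Gamma_0\cong G_0/\Gamma_0'$. -/

import Mathlib

universe u v w

namespace RegCover

/-! ### Coloured multigraphs with half-edges -/

/-- The type of an edge, recorded at a half-edge of it. In a directed edge one of the two
half-edges is `outgoing` (the one at the tail) and the other one is `incoming`. -/
inductive Kind : Type
  | halvable
  | undirected
  | outgoing
  | incoming

/-- What the opposite half-edge of the same edge records. -/
def Kind.opp : Kind → Kind
  | halvable => halvable
  | undirected => undirected
  | outgoing => incoming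
  | incoming => outgoing

/-- A multigraph with vertex set `V`, set of half-edges `D`, and edges coloured by `C` and of
the three types halvable, undirected and directed. The half-edge `d` is attached to `src d`, and
`inv d` is the other half-edge of the edge of `d`. A loop has two half-edges attached to the same
vertex; `inv d = d` means that `d` has a free end (the opposite half-edge is missing). -/
structure ColGraph (V : Type u) (D : Type v) (C : Type w) where
  src : D → V
  inv : D → D
  inv_inv : ∀ d, inv (inv d) = d
  color : D → C
  color_inv : ∀ d, color (inv d) = color d
  kind : D → Kind
  kind_inv : ∀ d, kind (inv d) = (kind d).opp

/-- Isomorphisms: bijections of the vertices and of the half-edges that preserve incidence, edges,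
colours, edge types and the direction of directed edges. -/
@[ext]
structure Iso {V₁ V₂ : Type u} {D₁ D₂ : Type v} {C : Type w}
    (G₁ : ColGraph V₁ D₁ C) (G₂ : ColGraph V₂ D₂ C) where
  toV : V₁ ≃ V₂
  toD : D₁ ≃ D₂
  src_map : ∀ d, G₂.src (toD d) = toV (G₁.src d)
  inv_map : ∀ d, G₂.inv (toD d) = toD (G₁.inv d)
  color_map : ∀ d, G₂.color (toD d) = G₁.color d
  kind_map : ∀ d, G₂.kind (toD d) = G₁.kind d

namespace Iso

variable {V₁ V₂ V₃ : Type u} {D₁ D₂ D₃ : Type v} {C : Type w}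
  {G₁ : ColGraph V₁ D₁ C} {G₂ : ColGraph V₂ D₂ C} {G₃ : ColGraph V₃ D₃ C}

def refl (G : ColGraph V₁ D₁ C) : Iso G G where
  toV := Equiv.refl _
  toD := Equiv.refl _
  src_map _ := rfl
  inv_map _ := rfl
  color_map _ := rfl
  kind_map _ := rfl

def symm (f : Iso G₁ G₂) : Iso G₂ G₁ where
  toV := f.toV.symm
  toD := f.toD.symm
  src_map d := by
    rw [Equiv.eq_symm_apply, ← f.src_map, Equiv.apply_symm_apply]
  inv_map d := by
    rw [Equiv.eq_symm_apply, ← f.inv_map, Equiv.apply_symm_apply]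
  color_map d := by
    rw [← f.color_map, Equiv.apply_symm_apply]
  kind_map d := by
    rw [← f.kind_map, Equiv.apply_symm_apply]

def trans (f : Iso G₁ G₂) (g : Iso G₂ G₃) : Iso G₁ G₃ where
  toV := f.toV.trans g.toV
  toD := f.toD.trans g.toD
  src_map d := by simp [g.src_map, f.src_map]
  inv_map d := by simp [g.inv_map, f.inv_map]
  color_map d := by simp [g.color_map, f.color_map]
  kind_map d := by simp [g.kind_map, f.kind_map]

end Iso

/-- The automorphism group of a coloured multigraph. -/
abbrev Aut {V : Type u} {D : Type v} {C : Type w} (G : ColGraph V D C) : Type (max u v) :=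
  Iso G G

/-- Multiplication of automorphisms is composition, `(π * ρ) x = π (ρ x)`. -/
instance {V : Type u} {D : Type v} {C : Type w} (G : ColGraph V D C) : Group (Aut G) where
  mul f g := Iso.trans g f
  one := Iso.refl G
  inv f := Iso.symm f
  mul_assoc _ _ _ := rfl
  one_mul _ := rfl
  mul_one _ := rfl
  inv_mul_cancel f := Iso.ext (Equiv.self_trans_symm f.toV) (Equiv.self_trans_symm f.toD)

section Basic

variable {V : Type u} {D : Type v} {C : Type w}

namespace ColGraph

/-- The graph contains no half-edge with a free end. -/
def NoHalfEdge (G : ColGraph V D C) : Prop := ∀ d, G.inv d ≠ d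

/-- The graph contains no loop. -/
def Loopless (G : ColGraph V D C) : Prop := ∀ d, G.inv d ≠ d → G.src (G.inv d) ≠ G.src d

/-- Adjacency of distinct vertices. -/
def simple (G : ColGraph V D C) : SimpleGraph V where
  Adj x y := x ≠ y ∧ ∃ d, G.src d = x ∧ G.src (G.inv d) = y
  symm := ⟨by
    rintro x y ⟨hne, d, hx, hy⟩
    exact ⟨hne.symm, G.inv d, hy, by rw [G.inv_inv, hx]⟩⟩
  loopless := ⟨fun _ h => h.1 rfl⟩

end ColGraph

/-! ### Semiregular groups and quotients -/

/-- A group of automorphisms is semiregular if no non-identity element fixes a vertex or a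
half-edge, and only halvable edges may have their two half-edges transposed. -/
def Semiregular (G : ColGraph V D C) (Γ : Subgroup (Aut G)) : Prop :=
  ∀ π ∈ Γ, π ≠ 1 →
    (∀ x, π.toV x ≠ x) ∧ (∀ d, π.toD d ≠ d) ∧ ∀ d, π.toD d = G.inv d → G.kind d = Kind.halvable

/-- Two vertices are in the same orbit of `Γ`. -/
def orbV {G : ColGraph V D C} (Γ : Subgroup (Aut G)) : Setoid V where
  r x y := ∃ π ∈ Γ, π.toV x = y
  iseqv :=
    { refl := fun _ => ⟨1, Γ.one_mem, rfl⟩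
      symm := by
        rintro x y ⟨π, hπ, rfl⟩
        exact ⟨π⁻¹, Γ.inv_mem hπ, π.toV.symm_apply_apply x⟩
      trans := by
        rintro x y z ⟨π, hπ, rfl⟩ ⟨ρ, hρ, rfl⟩
        exact ⟨ρ * π, Γ.mul_mem hρ hπ, rfl⟩ }

/-- Two half-edges are in the same orbit of `Γ`. -/
def orbD {G : ColGraph V D C} (Γ : Subgroup (Aut G)) : Setoid D where
  r x y := ∃ π ∈ Γ, π.toD x = y
  iseqv :=
    { refl := fun _ => ⟨1, Γ.one_mem, rfl⟩
      symm := by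
        rintro x y ⟨π, hπ, rfl⟩
        exact ⟨π⁻¹, Γ.inv_mem hπ, π.toD.symm_apply_apply x⟩
      trans := by
        rintro x y z ⟨π, hπ, rfl⟩ ⟨ρ, hρ, rfl⟩
        exact ⟨ρ * π, Γ.mul_mem hρ hπ, rfl⟩ }

/-- The quotient `G / Γ`: its vertices and half-edges are the orbits of `Γ` on the vertices and on
the half-edges of `G`; colours, edge types and directions are preserved. An edge of `G` becomes a
half-edge with a free end exactly if its two half-edges lie in one orbit. -/
def quot (G : ColGraph V D C) (Γ : Subgroup (Aut G)) :
    ColGraph (Quotient (orbV Γ)) (Quotient (orbD Γ)) C where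
  src := Quotient.lift (fun d => Quotient.mk (orbV Γ) (G.src d)) (by
    rintro d _ ⟨π, hπ, rfl⟩
    exact Quotient.sound ⟨π, hπ, (π.src_map d).symm⟩)
  inv := Quotient.lift (fun d => Quotient.mk (orbD Γ) (G.inv d)) (by
    rintro d _ ⟨π, hπ, rfl⟩
    exact Quotient.sound ⟨π, hπ, (π.inv_map d).symm⟩)
  inv_inv := by
    rintro ⟨d⟩
    exact congrArg (Quotient.mk (orbD Γ)) (G.inv_inv d)
  color := Quotient.lift G.color (by
    rintro d _ ⟨π, _, rfl⟩
    exact (π.color_map d).symm)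
  color_inv := by
    rintro ⟨d⟩
    exact G.color_inv d
  kind := Quotient.lift G.kind (by
    rintro d _ ⟨π, _, rfl⟩
    exact (π.kind_map d).symm)
  kind_inv := by
    rintro ⟨d⟩
    exact G.kind_inv d

/-! ### Subgraphs, components, blocks, the block-tree and its centre -/

/-- A subgraph: a set of vertices and a set of edges with all their end-vertices. -/
@[ext]
structure Sub (G : ColGraph V D C) where
  verts : Set V
  darts : Set D
  inv_mem : ∀ d ∈ darts, G.inv d ∈ darts
  src_mem : ∀ d ∈ darts, G.src d ∈ verts

namespace Sub

variable {G : ColGraph V D C}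

/-- A subgraph as a coloured multigraph in its own right. -/
def graph (A : Sub G) : ColGraph A.verts A.darts C where
  src d := ⟨G.src d.1, A.src_mem d.1 d.2⟩
  inv d := ⟨G.inv d.1, A.inv_mem d.1 d.2⟩
  inv_inv d := Subtype.ext (G.inv_inv d.1)
  color d := G.color d.1
  color_inv d := G.color_inv d.1
  kind d := G.kind d.1
  kind_inv d := G.kind_inv d.1

/-- The image of a subgraph under an automorphism. -/
def map (π : Aut G) (A : Sub G) : Sub G where
  verts := π.toV '' A.verts
  darts := π.toD '' A.darts
  inv_mem := by
    rintro _ ⟨d, hd, rfl⟩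
    exact ⟨G.inv d, A.inv_mem d hd, (π.inv_map d).symm⟩
  src_mem := by
    rintro _ ⟨d, hd, rfl⟩
    exact ⟨G.src d, A.src_mem d hd, (π.src_map d).symm⟩

end Sub

/-- The subgraph of `G` induced by a set of vertices. -/
def induced (G : ColGraph V D C) (W : Set V) : Sub G where
  verts := W
  darts := {d | G.src d ∈ W ∧ G.src (G.inv d) ∈ W}
  inv_mem d hd := ⟨hd.2, by rw [G.inv_inv]; exact hd.1⟩
  src_mem _ hd := hd.1

/-- The subgraph of `G` that consists of the vertices of `K`, the vertices `x` and `y`, the edges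
within `K`, and the edges between `K` and `{x, y}`. -/
def attached (G : ColGraph V D C) (K : Set V) (x y : V) : Sub G where
  verts := K ∪ {x, y}
  darts := {d | G.src d ∈ K ∪ {x, y} ∧ G.src (G.inv d) ∈ K ∪ {x, y} ∧
    (G.src d ∈ K ∨ G.src (G.inv d) ∈ K)}
  inv_mem d hd := ⟨hd.2.1, by rw [G.inv_inv]; exact hd.1, by rw [G.inv_inv]; exact hd.2.2.symm⟩
  src_mem _ hd := hd.1

/-- `K` is the vertex set of a connected component of `G` with the vertices of `X` removed. -/
def IsComponent (G : ColGraph V D C) (X K : Set V) : Prop :=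
  K.Nonempty ∧ Disjoint K X ∧ (G.simple.induce K).Preconnected ∧
    ∀ x ∈ K, ∀ y, G.simple.Adj x y → y ∈ K ∨ y ∈ X

/-- `x` is an articulation of the connected graph `G`. -/
def IsArticulation (G : ColGraph V D C) (x : V) : Prop :=
  ¬ (G.simple.induce ({x}ᶜ : Set V)).Preconnected

/-- `B` is the vertex set of a block of `G`: a maximal connected subgraph that has no articulation
of its own. (Bridges and pendant edges are blocks.) -/
def IsBlock (G : ColGraph V D C) (B : Set V) : Prop :=
  Maximal (fun W : Set V => W.Nonempty ∧ (G.simple.induce W).Preconnected ∧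
    ∀ x ∈ W, (G.simple.induce (W \ {x})).Preconnected) B

/-- The block-tree: the incidence graph between the blocks and the articulations of `G`. -/
def blockTree (G : ColGraph V D C) :
    SimpleGraph ({B : Set V // IsBlock G B} ⊕ {x : V // IsArticulation G x}) :=
  SimpleGraph.fromRel fun a b =>
    match a, b with
    | Sum.inl B, Sum.inr x => x.1 ∈ B.1
    | _, _ => False

/-- `R` is the vertex set of the central block of `G`, or `R = {x}` for the central articulation `x`
of `G`, whichever of the two is the centre of the block-tree. -/
def IsCentre (G : ColGraph V D C) (R : Set V) : Prop :=
  (∃ B, Sum.inl B ∈ (blockTree G).center ∧ R = B.1) ∨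
    (∃ x, Sum.inr x ∈ (blockTree G).center ∧ R = {x.1})

/-! ### Parts and atoms, relative to a centre `R` -/

/-- A block part: it is not a pendant edge, and it is induced by the blocks of a subtree of the
block-tree, where the block-tree is rooted at the centre and a subtree consists of a node other
than the centre and all its descendants. If this node is a block that has the articulation `x` as
its parent, the subtree covers `x` and one connected component of `G - x` that avoids the centre;
if it is the articulation `x`, the subtree covers `x` and all connected components of `G - x` that
avoid the centre. -/
def IsBlockPart (G : ColGraph V D C) (R : Set V) (A : Sub G) : Prop :=
  (∃ x K, IsArticulation G x ∧ K.Nonempty ∧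
    ((IsComponent G {x} K ∧ Disjoint K R) ∨
      (R ≠ {x} ∧ K = ⋃₀ {L | IsComponent G {x} L ∧ Disjoint L R})) ∧
    A = induced G (K ∪ {x})) ∧
  ¬ ∃ d, A.darts = {d, G.inv d}

/-- `{x, y}` is a non-trivial 2-cut of the block with vertex set `B`: it disconnects the block, and
`x` and `y` have degree at least three in the block. -/
def IsNontrivialCut (G : ColGraph V D C) (B : Set V) (x y : V) : Prop :=
  x ∈ B ∧ y ∈ B ∧ x ≠ y ∧ ¬ (G.simple.induce (B \ {x, y})).Preconnected ∧
    3 ≤ {d | G.src d = x ∧ G.src (G.inv d) ∈ B}.ncard ∧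
    3 ≤ {d | G.src d = y ∧ G.src (G.inv d) ∈ B}.ncard

/-- A proper part: for a non-trivial 2-cut `{x, y}` of a block `B`, a connected component `K` of
`G - {x, y}` that meets `B`, together with `x`, `y` and all edges between `K` and `{x, y}`; it must
not contain the centre. -/
def IsProperPart (G : ColGraph V D C) (R : Set V) (A : Sub G) : Prop :=
  ∃ B x y K, IsBlock G B ∧ IsNontrivialCut G B x y ∧ IsComponent G {x, y} K ∧ (K ∩ B).Nonempty ∧
    A = attached G K x y ∧ ¬ R ⊆ A.verts

/-- A dipole: the subgraph induced by two distinct vertices of degree at least three that are joined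
by at least two parallel edges. -/
def IsDipole (G : ColGraph V D C) (A : Sub G) : Prop :=
  ∃ x y, x ≠ y ∧ 3 ≤ {d | G.src d = x}.ncard ∧ 3 ≤ {d | G.src d = y}.ncard ∧
    2 ≤ {d | G.src d = x ∧ G.src (G.inv d) = y}.ncard ∧ A = induced G {x, y}

def IsPart (G : ColGraph V D C) (R : Set V) (A : Sub G) : Prop :=
  IsBlockPart G R A ∨ IsProperPart G R A ∨ IsDipole G A

/-- The atoms are the inclusion-minimal parts. -/
def IsAtom (G : ColGraph V D C) (R : Set V) (A : Sub G) : Prop :=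
  IsPart G R A ∧
    ∀ A', IsPart G R A' → A'.verts ⊆ A.verts → A'.darts ⊆ A.darts → A' = A

/-- The block atoms. A minimal part that is at the same time a block part and a dipole counts as a
dipole. -/
def IsBlockAtom (G : ColGraph V D C) (R : Set V) (A : Sub G) : Prop :=
  IsAtom G R A ∧ IsBlockPart G R A ∧ ¬ IsDipole G A

/-- The boundary of an atom: both vertices of a dipole, and otherwise the vertices that are
incident with an edge outside of the atom. -/
def boundary {G : ColGraph V D C} (A : Sub G) : Set V :=
  {x | x ∈ A.verts ∧ (IsDipole G A ∨ ∃ d, d ∉ A.darts ∧ G.src d = x)}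

/-- The vertex `x` is not in the interior of an atom. -/
def KeptV (G : ColGraph V D C) (R : Set V) (x : V) : Prop :=
  ∀ A, IsAtom G R A → x ∈ A.verts → x ∈ boundary A

/-- The half-edge `d` does not belong to an atom. -/
def KeptD (G : ColGraph V D C) (R : Set V) (d : D) : Prop :=
  ∀ A, IsAtom G R A → d ∉ A.darts

/-- `f` is an isomorphism of atoms: it maps the boundary onto the boundary. -/
def MapsBoundary {G : ColGraph V D C} {A A' : Sub G} (f : Iso A.graph A'.graph) : Prop :=
  ∀ x, x.1 ∈ boundary A ↔ (f.toV x).1 ∈ boundary A'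

/-- The automorphism `τ` of an atom exchanges the two vertices of the boundary. -/
def Exchanges {G : ColGraph V D C} {A : Sub G} (τ : Aut A.graph) : Prop :=
  ∀ x, x.1 ∈ boundary A → (τ.toV x).1 ∈ boundary A ∧ τ.toV x ≠ x

/-- A semiregular involution exchanges the two boundary vertices. -/
def IsHalvable {G : ColGraph V D C} (A : Sub G) : Prop :=
  ∃ τ : Aut A.graph, τ * τ = 1 ∧ Semiregular A.graph (Subgroup.zpowers τ) ∧ Exchanges τ

/-- Some automorphism exchanges the two boundary vertices. -/
def IsSwappable {G : ColGraph V D C} (A : Sub G) : Prop :=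
  ∃ τ : Aut A.graph, Exchanges τ

/-! ### The reduction -/

/-- The end-vertices of the edge that replaces the atom `A`: the boundary of `A`, and for a block
atom also the new pendant vertex, which is denoted by `Sum.inr A`. -/
def ends (G : ColGraph V D C) (R : Set V) (A : Sub G) : Set (V ⊕ Sub G) :=
  {x | (∃ y ∈ boundary A, x = Sum.inl y) ∨ (IsBlockAtom G R A ∧ x = Sum.inr A)}

/-- The action of an automorphism on vertices and on atoms. -/
def actV {G : ColGraph V D C} (π : Aut G) : V ⊕ Sub G → V ⊕ Sub G :=
  Sum.map π.toV (Sub.map π)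

/-- The action of an automorphism on half-edges, and on pairs of an atom and an end of it. -/
def actD {G : ColGraph V D C} (π : Aut G) :
    D ⊕ (Sub G × (V ⊕ Sub G)) → D ⊕ (Sub G × (V ⊕ Sub G)) :=
  Sum.map π.toD (Prod.map (Sub.map π) (actV π))

/-- `G'` arises from `G` by replacing every atom (with respect to the centre `R`) by an edge.
The maps `labelV` and `labelD` tell where the vertices and the half-edges of `G'` come from:
`Sum.inl` marks those common with `G`, the vertex `Sum.inr A` is the pendant vertex created for the
block atom `A`, and `Sum.inr (A, x)` is the half-edge at the end `x` of the edge that replaces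
the atom `A`. -/
structure Reduction {V' : Type u} {D' : Type v} (G : ColGraph V D C) (R : Set V)
    (G' : ColGraph V' D' C) where
  labelV : V' → V ⊕ Sub G
  labelD : D' → D ⊕ (Sub G × (V ⊕ Sub G))
  labelV_injective : Function.Injective labelV
  labelD_injective : Function.Injective labelD
  range_labelV : Set.range labelV =
    {x | (∃ y, KeptV G R y ∧ x = Sum.inl y) ∨ (∃ A, IsBlockAtom G R A ∧ x = Sum.inr A)}
  range_labelD : Set.range labelD =
    {d | (∃ e, KeptD G R e ∧ d = Sum.inl e) ∨
      (∃ A x, IsAtom G R A ∧ x ∈ ends G R A ∧ d = Sum.inr (A, x))}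
  /-- The common edges are unchanged. -/
  kept : ∀ d' d, labelD d' = Sum.inl d →
    labelV (G'.src d') = Sum.inl (G.src d) ∧ labelD (G'.inv d') = Sum.inl (G.inv d) ∧
      G'.color d' = G.color d ∧ G'.kind d' = G.kind d
  /-- A new edge joins the two ends of the atom that it replaces. -/
  new_edge : ∀ d' A x, labelD d' = Sum.inr (A, x) →
    labelV (G'.src d') = x ∧ ∃ y, y ≠ x ∧ labelD (G'.inv d') = Sum.inr (A, y)
  /-- The colours of the new edges are not used in `G`, -/
  new_color : ∀ d' A x, labelD d' = Sum.inr (A, x) → ∀ d, G.color d ≠ G'.color d'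
  /-- and they encode the isomorphism classes of atoms. -/
  color_iff : ∀ d' A x e' B y, labelD d' = Sum.inr (A, x) → labelD e' = Sum.inr (B, y) →
    (G'.color d' = G'.color e' ↔ ∃ f : Iso A.graph B.graph, MapsBoundary f)
  /-- The type of a new edge encodes the symmetry type of the atom. -/
  kind_block : ∀ d' A x, labelD d' = Sum.inr (A, x) → IsBlockAtom G R A →
    G'.kind d' = Kind.undirected
  kind_halvable : ∀ d' A x, labelD d' = Sum.inr (A, x) → ¬ IsBlockAtom G R A → IsHalvable A →
    G'.kind d' = Kind.halvable
  kind_symmetric : ∀ d' A x, labelD d' = Sum.inr (A, x) → ¬ IsBlockAtom G R A →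
    ¬ IsHalvable A → IsSwappable A → G'.kind d' = Kind.undirected
  kind_asymmetric : ∀ d' A x, labelD d' = Sum.inr (A, x) → ¬ IsBlockAtom G R A →
    ¬ IsSwappable A → G'.kind d' = Kind.outgoing ∨ G'.kind d' = Kind.incoming
  /-- Isomorphic asymmetric atoms are replaced by consistently directed edges. -/
  consistent : ∀ d' e' (A B : Sub G) (f : Iso A.graph B.graph) (x : A.verts),
    labelD d' = Sum.inr (A, Sum.inl x.1) → labelD e' = Sum.inr (B, Sum.inl (f.toV x).1) →
    MapsBoundary f → ¬ IsBlockAtom G R A → ¬ IsSwappable A → G'.kind d' = G'.kind e'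

namespace Reduction

variable {V' : Type u} {D' : Type v} {G : ColGraph V D C} {R : Set V} {G' : ColGraph V' D' C}

/-- `π'` is the image of `π` under the reduction epimorphism from `Aut G` to `Aut G'`: it acts like
`π` on the common vertices and edges, and maps the edge that replaces an atom `A` to the edge that
replaces `π(A)`, with the half-edge at an end `x` mapped to the half-edge at `π(x)`. -/
def IsImage (S : Reduction G R G') (π : Aut G) (π' : Aut G') : Prop :=
  (∀ x, S.labelV (π'.toV x) = actV π (S.labelV x)) ∧
    ∀ d, S.labelD (π'.toD d) = actD π (S.labelD d)

/-- `Γ` extends `Γ'`: the image of `Γ` under the reduction epimorphism is `Γ'`. -/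
def Extends (S : Reduction G R G') (Γ : Subgroup (Aut G)) (Γ' : Subgroup (Aut G')) : Prop :=
  (∀ π ∈ Γ, ∃ π' ∈ Γ', S.IsImage π π') ∧ ∀ π' ∈ Γ', ∃ π ∈ Γ, S.IsImage π π'

/-- An isomorphism `φ` between quotients of `G` and an isomorphism `ψ` between quotients of `G'`
agree on the vertices and the half-edges that the quotients of `G` and of `G'` have in common. -/
def Agree (S : Reduction G R G') {Γ Δ : Subgroup (Aut G)} {Γ' Δ' : Subgroup (Aut G')}
    (φ : Iso (quot G Γ) (quot G Δ)) (ψ : Iso (quot G' Γ') (quot G' Δ')) : Prop :=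
  (∀ x' y' x y, S.labelV x' = Sum.inl x → S.labelV y' = Sum.inl y →
    ψ.toV (Quotient.mk (orbV Γ') x') = Quotient.mk (orbV Δ') y' →
    φ.toV (Quotient.mk (orbV Γ) x) = Quotient.mk (orbV Δ) y) ∧
  ∀ d' e' d e, S.labelD d' = Sum.inl d → S.labelD e' = Sum.inl e →
    ψ.toD (Quotient.mk (orbD Γ') d') = Quotient.mk (orbD Δ') e' →
    φ.toD (Quotient.mk (orbD Γ) d) = Quotient.mk (orbD Δ) e

end Reduction

end Basic

/-- A reduction series `G₀, …, G_r` of a finite connected graph `G₀` without loops and half-edges.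
The atoms are taken with respect to the central block or articulation of `G₀` in all steps; the
vertices of the central block of `G₀` that are still present in `Gᵢ` form its `centre i`. The series
stops as soon as a graph without atoms (a primitive graph) is reached. -/
structure ReductionSeries (C : Type w) (r : ℕ) where
  V : Fin (r + 1) → Type u
  D : Fin (r + 1) → Type v
  graph : ∀ i, ColGraph (V i) (D i) C
  centre : ∀ i, Set (V i)
  finite_V : Finite (V 0)
  finite_D : Finite (D 0)
  connected : (graph 0).simple.Connected
  loopless : (graph 0).Loopless
  noHalfEdge : (graph 0).NoHalfEdge
  isCentre : IsCentre (graph 0) (centre 0)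
  step : ∀ i : Fin r, Reduction (graph i.castSucc) (centre i.castSucc) (graph i.succ)
  centre_succ : ∀ i : Fin r,
    centre i.succ = {x' | ∃ x ∈ centre i.castSucc, (step i).labelV x' = Sum.inl x}
  exists_atom : ∀ i : Fin r, ∃ A, IsAtom (graph i.castSucc) (centre i.castSucc) A
  primitive : ∀ A, ¬ IsAtom (graph (Fin.last r)) (centre (Fin.last r)) A

namespace ReductionSeries

variable {C : Type w} {r : ℕ}

/-- A choice of semiregular groups `Γᵢ ≤ Aut Gᵢ` such that `Γᵢ` extends `Γᵢ₊₁` for all `i < r`. The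
quotients `Gᵢ / Γᵢ` then form an expansion series. -/
def IsExpansion (S : ReductionSeries.{u, v, w} C r)
    (Γ : ∀ i, Subgroup (Aut (S.graph i))) : Prop :=
  (∀ i, Semiregular (S.graph i) (Γ i)) ∧
    ∀ i : Fin r, (S.step i).Extends (Γ i.castSucc) (Γ i.succ)

end ReductionSeries

end RegCover

namespace RegCover

/-! ### Components, and the shape of block parts and proper parts -/

section Graph

variable {V : Type u} {D : Type v} {C : Type w}

/-! The new edges encode the atoms up to isomorphism, ends included: if two new half-edges at
boundary vertices agree in colour and kind, some isomorphism of their atoms matches these ends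
(`exists_subIso_of_color_eq`). Hence an isomorphism ψ of the reduced quotients can be continued into
the interiors of the atoms.

To do this consistently, one picks one atom from each orbit and maps it by such an isomorphism; the
groups determine the rest. The only obstruction is a non-identity group element that maps an atom to
itself. It would fix or reverse the new edge: fixing contradicts semiregularity, and reversing
creates a half-edge of the quotient. Without half-edges the groups therefore act freely on the atoms
(`Extends.eq_one_of_map_eq`). Since distinct atoms share neither interior vertices nor edges
(`atom_eq_of_interior`, `atom_eq_of_dart`), the pieces glue to an isomorphism of the quotients
(`Matching.exists_iso`, `exists_agree`).

For existence, the same gluing with trivial groups lifts single automorphisms (`exists_lift`). To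
make the lifts a group, each atom gets an isomorphism from the base atom of its orbit, used as
coordinates, and the lifts that preserve all coordinates are taken (`exists_extends`).

For odd order, an element that reverses an edge would be an involution, so no quotient has a
half-edge (`Semiregular.noHalfEdge_of_odd`). The order does not change under extension
(`Extends.natCard_eq`), and connectedness and the absence of loops and half-edges pass to each
reduced graph, so the single step can be iterated. -/

theorem exists_adj_of_preconnected_induce {H : SimpleGraph V} {W K : Set V}
    (hW : (H.induce W).Preconnected) {a b : V} (haW : a ∈ W) (haK : a ∈ K) (hbW : b ∈ W)
    (hbK : b ∉ K) : ∃ c ∈ K, ∃ w ∈ W, w ∉ K ∧ H.Adj c w := by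
  obtain ⟨p⟩ := hW ⟨a, haW⟩ ⟨b, hbW⟩
  obtain ⟨e, -, h₁, h₂⟩ := p.exists_boundary_dart (Subtype.val ⁻¹' K) haK hbK
  exact ⟨e.fst.1, h₁, e.snd.1, e.snd.2, h₂, e.adj⟩

theorem exists_adj_of_connected {H : SimpleGraph V} (hH : H.Connected) {K : Set V} {a b : V}
    (ha : a ∈ K) (hb : b ∉ K) : ∃ c ∈ K, ∃ w, w ∉ K ∧ H.Adj c w := by
  obtain ⟨p⟩ := hH.preconnected a b
  obtain ⟨e, -, h₁, h₂⟩ := p.exists_boundary_dart K ha hb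
  exact ⟨e.fst, h₁, e.snd, h₂, e.adj⟩

variable {G : ColGraph V D C} {R : Set V}

theorem IsComponent.src_inv_mem {X K : Set V} (h : IsComponent G X K) {d : D}
    (hd : G.src d ∈ K) : G.src (G.inv d) ∈ K ∪ X := by
  by_cases he : G.src d = G.src (G.inv d)
  · exact Or.inl (he ▸ hd)
  · exact h.2.2.2 _ hd _ ⟨he, d, rfl, rfl⟩

theorem IsComponent.subset_of_preconnected {X K L : Set V} (h : IsComponent G X K)
    (hL : (G.simple.induce L).Preconnected) (hLX : ∀ x ∈ L, x ∉ X) {z : V} (hzL : z ∈ L)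
    (hzK : z ∈ K) : L ⊆ K := by
  intro y hy
  by_contra hyK
  obtain ⟨c, hc, w, hw, hwK, hadj⟩ := exists_adj_of_preconnected_induce hL hzL hzK hy hyK
  exact (h.2.2.2 c hc w hadj).elim hwK (hLX w hw)

theorem IsComponent.not_mem {X K : Set V} (h : IsComponent G X K) : ∀ x ∈ K, x ∉ X :=
  fun _ hx hX => Set.disjoint_left.1 h.2.1 hx hX

theorem IsComponent.eq {X K L : Set V} (hK : IsComponent G X K) (hL : IsComponent G X L) {z : V}
    (hzK : z ∈ K) (hzL : z ∈ L) : K = L :=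
  (hL.subset_of_preconnected hK.2.2.1 hK.not_mem hzK hzL).antisymm
    (hK.subset_of_preconnected hL.2.2.1 hL.not_mem hzL hzK)

theorem IsDipole.boundary_eq {A : Sub G} (h : IsDipole G A) : boundary A = A.verts :=
  Set.ext fun _ => ⟨fun hx => hx.1, fun hx => ⟨hx, Or.inl h⟩⟩

theorem IsDipole.exists_pair {A : Sub G} (h : IsDipole G A) :
    ∃ x y, x ≠ y ∧ A = induced G {x, y} := by
  obtain ⟨x, y, hxy, -, -, -, hA⟩ := h
  exact ⟨x, y, hxy, hA⟩

theorem induced_subset {W W' : Set V} (h : W ⊆ W') :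
    (induced G W).verts ⊆ (induced G W').verts ∧ (induced G W).darts ⊆ (induced G W').darts :=
  ⟨h, fun _ hd => ⟨h hd.1, h hd.2⟩⟩

/-- As K is a union of components of G - x, edges leave it only towards x, which leaves x as the
only candidate for the boundary. The final alternative keeps just what is needed to compare two
block parts at the same articulation. -/
theorem IsBlockPart.exists_eq_induced {A : Sub G} (h : IsBlockPart G R A) (hd : ¬ IsDipole G A) :
    ∃ x K, x ∉ K ∧ A = induced G (K ∪ {x}) ∧ boundary A ⊆ {x} ∧
      (∀ z ∈ K, ∃ L ⊆ K, z ∈ L ∧ IsComponent G {x} L) ∧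
      (IsComponent G {x} K ∨ K = ⋃₀ {L | IsComponent G {x} L ∧ Disjoint L R}) := by
  obtain ⟨⟨x, K, -, -, hK, rfl⟩, -⟩ := h
  have hcomp : ∀ z ∈ K, ∃ L ⊆ K, z ∈ L ∧ IsComponent G {x} L := by
    intro z hz
    rcases hK with ⟨hK, -⟩ | ⟨-, rfl⟩
    · exact ⟨K, subset_rfl, hz, hK⟩
    · obtain ⟨L, hL, hzL⟩ := hz
      exact ⟨L, Set.subset_sUnion_of_mem hL, hzL, hL.1⟩
  refine ⟨x, K, ?_, rfl, ?_, hcomp, hK.imp And.left And.right⟩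
  · intro hx
    obtain ⟨L, -, hxL, hL⟩ := hcomp x hx
    exact hL.not_mem x hxL rfl
  · rintro z ⟨hz, hz' | ⟨d, hdA, rfl⟩⟩
    · exact absurd hz' hd
    · rcases hz with hz | hz
      · obtain ⟨L, hLK, hzL, hL⟩ := hcomp _ hz
        exact absurd ⟨Or.inl hz, (hL.src_inv_mem hzL).imp (fun h => hLK h) id⟩ hdA
      · exact hz

/-- The boundary is non-empty because the part misses a vertex of the centre and G is connected.
Both x and y have neighbours in K because a block stays connected when one vertex is removed. -/
theorem IsProperPart.exists_eq_attached {A : Sub G} (hc : G.simple.Connected)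
    (h : IsProperPart G R A) (hd : ¬ IsDipole G A) :
    ∃ x y K, A = attached G K x y ∧ IsComponent G {x, y} K ∧ boundary A ⊆ {x, y} ∧
      (boundary A).Nonempty ∧ (∃ c ∈ K, G.simple.Adj c x) ∧ ∃ c ∈ K, G.simple.Adj c y := by
  obtain ⟨B, x, y, K, hB, ⟨hxB, hyB, hxy, -⟩, hK, ⟨a, haK, haB⟩, rfl, hR⟩ := h
  have hsub : boundary (attached G K x y) ⊆ {x, y} := by
    rintro z ⟨hz, hz' | ⟨d, hdA, rfl⟩⟩
    · exact absurd hz' hd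
    · rcases hz with hz | hz
      · exact absurd ⟨Or.inl hz, hK.src_inv_mem hz, Or.inl hz⟩ hdA
      · exact hz
  have hax : a ≠ x := fun h => hK.not_mem a haK (Or.inl h)
  have hay : a ≠ y := fun h => hK.not_mem a haK (Or.inr h)
  have hxK : x ∉ K := fun h => hK.not_mem x h (Or.inl rfl)
  have hyK : y ∉ K := fun h => hK.not_mem y h (Or.inr rfl)
  refine ⟨x, y, K, rfl, hK, hsub, ?_, ?_, ?_⟩
  · obtain ⟨b, -, hb⟩ := Set.not_subset.1 hR
    obtain ⟨c, hcA, w, hw, hadj⟩ := exists_adj_of_connected hc (Or.inl haK) hb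
    obtain ⟨-, d, rfl, rfl⟩ := hadj
    exact ⟨_, hcA, Or.inr ⟨d, fun h => hw h.2.1, rfl⟩⟩
  -- Inside B - y a path from a to x must leave K, and x is the only exit.
  · obtain ⟨c, hcK, w, hw, hwK, hadj⟩ := exists_adj_of_preconnected_induce
      (hB.prop.2.2 y hyB) ⟨haB, hay⟩ haK ⟨hxB, hxy⟩ hxK
    rcases hK.2.2.2 c hcK w hadj with h | rfl | h
    · exact absurd h hwK
    · exact ⟨c, hcK, hadj⟩
    · exact absurd h hw.2
  · obtain ⟨c, hcK, w, hw, hwK, hadj⟩ := exists_adj_of_preconnected_induce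
      (hB.prop.2.2 x hxB) ⟨haB, hax⟩ haK ⟨hyB, hxy.symm⟩ hyK
    rcases hK.2.2.2 c hcK w hadj with h | h | rfl
    · exact absurd h hwK
    · exact absurd h hw.2
    · exact ⟨c, hcK, hadj⟩

theorem IsAtom.properPart_of_not {A : Sub G} (hA : IsAtom G R A) (hd : ¬ IsDipole G A)
    (hb : ¬ IsBlockAtom G R A) : IsProperPart G R A := by
  rcases hA.1 with h | h | h
  · exact absurd ⟨hA, h, hd⟩ hb
  · exact h
  · exact absurd h hd

end Graph

/-! ### Boundaries of atoms, and disjointness of their interiors -/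

namespace Reduction

variable {V : Type u} {D : Type v} {C : Type w} {V' : Type u} {D' : Type v}
  {G : ColGraph V D C} {R : Set V} {G' : ColGraph V' D' C}

theorem exists_labelD (S : Reduction G R G') {A : Sub G} {x : V ⊕ Sub G} (hA : IsAtom G R A)
    (hx : x ∈ ends G R A) : ∃ d', S.labelD d' = Sum.inr (A, x) := by
  have : Sum.inr (A, x) ∈ Set.range S.labelD := by
    rw [S.range_labelD]
    exact Or.inr ⟨A, x, hA, hx, rfl⟩
  exact this

theorem exists_labelD_inl (S : Reduction G R G') {A : Sub G} {b : V} (hA : IsAtom G R A)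
    (hb : b ∈ boundary A) : ∃ d', S.labelD d' = Sum.inr (A, Sum.inl b) :=
  S.exists_labelD hA (Or.inl ⟨b, hb, rfl⟩)

theorem exists_labelD_kept (S : Reduction G R G') {d : D} (hd : KeptD G R d) :
    ∃ d', S.labelD d' = Sum.inl d := by
  have : Sum.inl d ∈ Set.range S.labelD := by
    rw [S.range_labelD]
    exact Or.inl ⟨d, hd, rfl⟩
  exact this

theorem exists_labelV_kept (S : Reduction G R G') {x : V} (hx : KeptV G R x) :
    ∃ x', S.labelV x' = Sum.inl x := by
  have : Sum.inl x ∈ Set.range S.labelV := by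
    rw [S.range_labelV]
    exact Or.inl ⟨x, hx, rfl⟩
  exact this

theorem keptV_of_labelV (S : Reduction G R G') {x' : V'} {x : V} (h : S.labelV x' = Sum.inl x) :
    KeptV G R x := by
  have : S.labelV x' ∈ Set.range S.labelV := ⟨x', rfl⟩
  rw [h, S.range_labelV] at this
  rcases this with ⟨y, hy, hxy⟩ | ⟨A, -, h⟩
  · rwa [Sum.inl_injective hxy]
  · cases h

theorem keptD_of_labelD (S : Reduction G R G') {d' : D'} {d : D} (h : S.labelD d' = Sum.inl d) :
    KeptD G R d := by
  have : S.labelD d' ∈ Set.range S.labelD := ⟨d', rfl⟩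
  rw [h, S.range_labelD] at this
  rcases this with ⟨y, hy, hxy⟩ | ⟨A, x, -, -, h⟩
  · rwa [Sum.inl_injective hxy]
  · cases h

theorem isBlockAtom_of_labelV (S : Reduction G R G') {x' : V'} {A : Sub G}
    (h : S.labelV x' = Sum.inr A) : IsBlockAtom G R A := by
  have : S.labelV x' ∈ Set.range S.labelV := ⟨x', rfl⟩
  rw [h, S.range_labelV] at this
  rcases this with ⟨y, hy, h⟩ | ⟨B, hB, h⟩
  · cases h
  · rwa [Sum.inr_injective h]

theorem isAtom_of_labelD (S : Reduction G R G') {d' : D'} {A : Sub G} {x : V ⊕ Sub G}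
    (h : S.labelD d' = Sum.inr (A, x)) : IsAtom G R A ∧ x ∈ ends G R A := by
  have : S.labelD d' ∈ Set.range S.labelD := ⟨d', rfl⟩
  rw [h, S.range_labelD] at this
  rcases this with ⟨y, hy, h⟩ | ⟨B, y, hB, hy, h⟩
  · cases h
  · cases Sum.inr_injective h
    exact ⟨hB, hy⟩

theorem mem_boundary_of_labelD (S : Reduction G R G') {d' : D'} {A : Sub G} {b : V}
    (h : S.labelD d' = Sum.inr (A, Sum.inl b)) : b ∈ boundary A := by
  rcases (S.isAtom_of_labelD h).2 with ⟨y, hy, h⟩ | ⟨-, h⟩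
  · rwa [Sum.inl_injective h]
  · cases h

theorem isBlockAtom_of_labelD (S : Reduction G R G') {d' : D'} {A B : Sub G}
    (h : S.labelD d' = Sum.inr (A, Sum.inr B)) : IsBlockAtom G R A ∧ B = A := by
  rcases (S.isAtom_of_labelD h).2 with ⟨y, hy, h⟩ | ⟨hA, h⟩
  · cases h
  · exact ⟨hA, Sum.inr_injective h⟩

/-- The new half-edge at b needs a vertex of G' labelled b, and only common vertices have such
labels. Here, as often below, the existence of the reduction replaces an argument about blocks and
cuts. -/
theorem keptV_of_mem_boundary (S : Reduction G R G') {A : Sub G} (hA : IsAtom G R A) {b : V}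
    (hb : b ∈ boundary A) : KeptV G R b := by
  obtain ⟨d', hd'⟩ := S.exists_labelD_inl hA hb
  exact S.keptV_of_labelV (S.new_edge d' _ _ hd').1

/-- New edges have two distinct ends. This yields that block atoms have exactly one boundary vertex,
and that the boundary of any other atom is never a single vertex. -/
theorem exists_ne_mem_ends (S : Reduction G R G') {A : Sub G} (hA : IsAtom G R A)
    {x : V ⊕ Sub G} (hx : x ∈ ends G R A) : ∃ y ∈ ends G R A, y ≠ x := by
  obtain ⟨d', hd'⟩ := S.exists_labelD hA hx
  obtain ⟨y, hy, hd''⟩ := (S.new_edge d' _ _ hd').2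
  exact ⟨y, (S.isAtom_of_labelD hd'').2, hy⟩

theorem exists_boundary_eq_singleton (S : Reduction G R G') {A : Sub G} (hA : IsBlockAtom G R A) :
    ∃ b, boundary A = {b} := by
  obtain ⟨x, K, -, -, hx, -⟩ := hA.2.1.exists_eq_induced hA.2.2
  obtain ⟨y, hy, hne⟩ := S.exists_ne_mem_ends hA.1 (Or.inr ⟨hA, rfl⟩)
  rcases hy with ⟨b, hb, -⟩ | ⟨-, h⟩
  · exact ⟨x, hx.antisymm (by rintro _ rfl; rwa [← hx hb])⟩
  · exact absurd h hne

theorem exists_ne_mem_boundary (S : Reduction G R G') {A : Sub G} (hA : IsAtom G R A)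
    (hb : ¬ IsBlockAtom G R A) {x : V} (hx : x ∈ boundary A) : ∃ y ∈ boundary A, y ≠ x := by
  obtain ⟨y, hy, hne⟩ := S.exists_ne_mem_ends hA (Or.inl ⟨x, hx, rfl⟩)
  rcases hy with ⟨z, hz, rfl⟩ | ⟨h, -⟩
  · exact ⟨z, hz, fun h => hne (congrArg _ h)⟩
  · exact absurd h hb

theorem boundary_eq_pair_of_subset (S : Reduction G R G') {A : Sub G} (hA : IsAtom G R A)
    (hb : ¬ IsBlockAtom G R A) {x y : V} (hne : (boundary A).Nonempty)
    (hs : boundary A ⊆ {x, y}) : x ≠ y ∧ boundary A = {x, y} := by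
  obtain ⟨a, ha⟩ := hne
  obtain ⟨c, hc, hca⟩ := S.exists_ne_mem_boundary hA hb ha
  rcases hs ha with rfl | rfl <;> rcases hs hc with rfl | rfl
  · exact absurd rfl hca
  · exact ⟨hca.symm, hs.antisymm (by rintro _ (rfl | rfl) <;> assumption)⟩
  · exact ⟨hca, hs.antisymm (by rintro _ (rfl | rfl) <;> assumption)⟩
  · exact absurd rfl hca

theorem exists_boundary_eq_pair (S : Reduction G R G') (hc : G.simple.Connected) {A : Sub G}
    (hA : IsAtom G R A) (hb : ¬ IsBlockAtom G R A) : ∃ x y, x ≠ y ∧ boundary A = {x, y} := by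
  by_cases hd : IsDipole G A
  · obtain ⟨x, y, hxy, rfl⟩ := hd.exists_pair
    exact ⟨x, y, hxy, hd.boundary_eq⟩
  · obtain ⟨x, y, K, -, -, hs, hne, -⟩ := (hA.properPart_of_not hd hb).exists_eq_attached hc hd
    exact ⟨x, y, S.boundary_eq_pair_of_subset hA hb hne hs⟩

theorem boundary_nonempty (S : Reduction G R G') (hc : G.simple.Connected) {A : Sub G}
    (hA : IsAtom G R A) : (boundary A).Nonempty := by
  by_cases hb : IsBlockAtom G R A
  · obtain ⟨b, h⟩ := S.exists_boundary_eq_singleton hb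
    exact h ▸ Set.singleton_nonempty b
  · obtain ⟨x, y, -, h⟩ := S.exists_boundary_eq_pair hc hA hb
    exact h ▸ ⟨x, Or.inl rfl⟩

/-- Counting boundary vertices recognises block atoms in a form that isomorphisms of atoms preserve.
-/
theorem isBlockAtom_iff (S : Reduction G R G') {A : Sub G}
    (hA : IsAtom G R A) (hne : (boundary A).Nonempty) :
    IsBlockAtom G R A ↔ (boundary A).Subsingleton := by
  refine ⟨fun h => ?_, fun h => by_contra fun hb => ?_⟩
  · obtain ⟨b, h⟩ := S.exists_boundary_eq_singleton h
    exact h ▸ Set.subsingleton_singleton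
  · obtain ⟨x, hx⟩ := hne
    obtain ⟨y, hy, hyx⟩ := S.exists_ne_mem_boundary hA hb hx
    exact hyx (h hy hx)

/-- An interior vertex recovers the boundary: it is the set of outer neighbours of the component of
that vertex. -/
theorem exists_component (S : Reduction G R G') (hc : G.simple.Connected) {A : Sub G}
    (hA : IsAtom G R A) (hd : ¬ IsDipole G A) {z : V} (hz : z ∈ A.verts) (hzb : z ∉ boundary A) :
    ∃ K ⊆ A.verts, z ∈ K ∧ IsComponent G (boundary A) K ∧
      ∀ b ∈ boundary A, ∃ c ∈ K, G.simple.Adj c b := by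
  by_cases hb : IsBlockAtom G R A
  · obtain ⟨x, K, hxK, rfl, hx, hK, -⟩ := hb.2.1.exists_eq_induced hd
    obtain ⟨b, hbd⟩ := S.exists_boundary_eq_singleton hb
    obtain rfl : b = x := by
      have : b ∈ boundary (induced G (K ∪ {x})) := by rw [hbd]; rfl
      exact hx this
    rw [hbd] at hzb ⊢
    have hzK : z ∈ K := hz.resolve_right hzb
    obtain ⟨L, hLK, hzL, hL⟩ := hK z hzK
    refine ⟨L, hLK.trans Set.subset_union_left, hzL, hL, ?_⟩
    rintro _ rfl
    obtain ⟨c, hcL, w, hw, hadj⟩ := exists_adj_of_connected hc hzL (fun h => hxK (hLK h))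
    rcases hL.2.2.2 c hcL w hadj with h | rfl
    · exact absurd h hw
    · exact ⟨c, hcL, hadj⟩
  · obtain ⟨x, y, K, rfl, hK, hs, hne, hx, hy⟩ :=
      (hA.properPart_of_not hd hb).exists_eq_attached hc hd
    obtain ⟨-, hbd⟩ := S.boundary_eq_pair_of_subset hA hb hne hs
    rw [hbd] at hzb ⊢
    refine ⟨K, Set.subset_union_left, hz.resolve_right hzb, hK, ?_⟩
    rintro _ (rfl | rfl)
    · exact hx
    · exact hy

theorem not_mem_boundary_of_mem_verts (S : Reduction G R G') {A B : Sub G} (hA : IsAtom G R A)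
    (hB : IsAtom G R B) {z : V} (hz : z ∈ A.verts) (hzb : z ∉ boundary A) : z ∉ boundary B :=
  fun h => hzb (S.keptV_of_mem_boundary hB h A hA hz)

theorem boundary_subset_of_component {A B : Sub G} {K : Set V} (hK : IsComponent G (boundary A) K)
    (hKB : IsComponent G (boundary B) K) (h : ∀ b ∈ boundary A, ∃ c ∈ K, G.simple.Adj c b) :
    boundary A ⊆ boundary B := by
  intro b hb
  obtain ⟨c, hc, hadj⟩ := h b hb
  exact (hKB.2.2.2 c hc b hadj).resolve_left fun h => hK.not_mem b h hb

theorem component_subset (S : Reduction G R G') {A B : Sub G} (hA : IsAtom G R A)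
    (hB : IsAtom G R B) {K L : Set V} {z : V} (hKA : K ⊆ A.verts)
    (hK : IsComponent G (boundary A) K) (hL : IsComponent G (boundary B) L)
    (hzK : z ∈ K) (hzL : z ∈ L) : K ⊆ L :=
  hL.subset_of_preconnected hK.2.2.1
    (fun x hx => S.not_mem_boundary_of_mem_verts hA hB (hKA hx) (hK.not_mem x hx)) hzK hzL

/-- The interiors of distinct atoms have no vertex in common. -/
theorem atom_eq_of_interior (S : Reduction G R G') (hc : G.simple.Connected) {A B : Sub G}
    (hA : IsAtom G R A) (hB : IsAtom G R B) {z : V} (hzA : z ∈ A.verts) (hzA' : z ∉ boundary A)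
    (hzB : z ∈ B.verts) : A = B := by
  have hzB' := S.not_mem_boundary_of_mem_verts hA hB hzA hzA'
  have hdA : ¬ IsDipole G A := fun h => hzA' (h.boundary_eq ▸ hzA)
  have hdB : ¬ IsDipole G B := fun h => hzB' (h.boundary_eq ▸ hzB)
  -- The two components of z avoid both boundaries, so they coincide, and so do their outer
  -- neighbours.
  have hbd : boundary A = boundary B := by
    obtain ⟨K, hKA, hzK, hK, hKadj⟩ := S.exists_component hc hA hdA hzA hzA'
    obtain ⟨L, hLB, hzL, hL, hLadj⟩ := S.exists_component hc hB hdB hzB hzB'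
    obtain rfl : K = L := (S.component_subset hA hB hKA hK hL hzK hzL).antisymm
      (S.component_subset hB hA hLB hL hK hzL hzK)
    exact (boundary_subset_of_component hK hL hKadj).antisymm
      (boundary_subset_of_component hL hK hLadj)
  have hiff : IsBlockAtom G R A ↔ IsBlockAtom G R B := by
    rw [S.isBlockAtom_iff hA (S.boundary_nonempty hc hA),
      S.isBlockAtom_iff hB (S.boundary_nonempty hc hB), hbd]
  by_cases hbA : IsBlockAtom G R A
  · have hbB := hiff.1 hbA
    obtain ⟨x, K, hxK, hAe, hx, hK, hK'⟩ := hbA.2.1.exists_eq_induced hdA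
    obtain ⟨y, L, hyL, hBe, hy, hL, hL'⟩ := hbB.2.1.exists_eq_induced hdB
    obtain rfl : x = y := by
      obtain ⟨b, hb⟩ := S.boundary_nonempty hc hA
      exact (hx hb).symm.trans (hy (hbd ▸ hb))
    obtain ⟨b, hb⟩ := S.exists_boundary_eq_singleton hbA
    obtain rfl : b = x := hx (hb ▸ rfl : b ∈ boundary A)
    have hzK : z ∈ K := by
      rw [hAe] at hzA
      exact hzA.resolve_right (hb ▸ hzA')
    have hzL : z ∈ L := by
      rw [hBe] at hzB
      exact hzB.resolve_right (hb ▸ hbd ▸ hzB')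
    -- If one of the two is a single component with its articulation, it lies inside the other,
    -- whose minimality gives equality. Otherwise both consist of all components avoiding the
    -- centre.
    rcases hK' with hK' | hK'
    · obtain ⟨M, hML, hzM, hM⟩ := hL z hzL
      obtain rfl := hK'.eq hM hzK hzM
      have := induced_subset (G := G) (Set.union_subset_union_left {b} hML)
      rw [← hAe, ← hBe] at this
      exact hB.2 A hA.1 this.1 this.2
    · rcases hL' with hL' | hL'
      · obtain ⟨M, hMK, hzM, hM⟩ := hK z hzK
        obtain rfl := hL'.eq hM hzL hzM
        have := induced_subset (G := G) (Set.union_subset_union_left {b} hMK)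
        rw [← hAe, ← hBe] at this
        exact (hA.2 B hB.1 this.1 this.2).symm
      · rw [hAe, hBe, hK', hL']
  · have hbB := fun h => hbA (hiff.2 h)
    obtain ⟨x, y, K, hAe, hK, hsA, hneA, -⟩ :=
      (hA.properPart_of_not hdA hbA).exists_eq_attached hc hdA
    obtain ⟨x', y', L, hBe, hL, hsB, hneB, -⟩ :=
      (hB.properPart_of_not hdB hbB).exists_eq_attached hc hdB
    have h₁ := (S.boundary_eq_pair_of_subset hA hbA hneA hsA).2
    have h₂ := (S.boundary_eq_pair_of_subset hB hbB hneB hsB).2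
    have h₃ : ({x, y} : Set V) = {x', y'} := by rw [← h₁, ← h₂, hbd]
    have hzK : z ∈ K := by
      rw [hAe] at hzA
      exact hzA.resolve_right (h₁ ▸ hzA')
    have hzL : z ∈ L := by
      rw [hBe] at hzB
      exact hzB.resolve_right (h₂ ▸ hzB')
    obtain rfl : K = L := (h₃ ▸ hK).eq hL hzK hzL
    rw [hAe, hBe]
    ext <;> simp only [attached, h₃]

/-- An edge between boundary vertices would be a loop in a block atom, and `attached` leaves out the
edges between the two cut vertices. -/
theorem src_not_mem_boundary_or (S : Reduction G R G') (hc : G.simple.Connected)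
    (hl : ∀ d, G.src (G.inv d) ≠ G.src d) {A : Sub G} (hA : IsAtom G R A) (hd : ¬ IsDipole G A)
    {d : D} (h : d ∈ A.darts) : G.src d ∉ boundary A ∨ G.src (G.inv d) ∉ boundary A := by
  by_cases hb : IsBlockAtom G R A
  · obtain ⟨b, hb⟩ := S.exists_boundary_eq_singleton hb
    rw [hb, ← not_and_or]
    rintro ⟨h₁, h₂⟩
    exact hl d (h₂.trans h₁.symm)
  · obtain ⟨x, y, K, rfl, hK, hs, -⟩ :=
      (hA.properPart_of_not hd hb).exists_eq_attached hc hd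
    exact h.2.2.imp (fun h h' => hK.not_mem _ h (hs h')) (fun h h' => hK.not_mem _ h (hs h'))

/-- Distinct atoms have no edge in common. -/
theorem atom_eq_of_dart (S : Reduction G R G') (hc : G.simple.Connected)
    (hl : ∀ d, G.src (G.inv d) ≠ G.src d) {A B : Sub G} (hA : IsAtom G R A) (hB : IsAtom G R B)
    {d : D} (hdA : d ∈ A.darts) (hdB : d ∈ B.darts) : A = B := by
  -- An edge of a non-dipole atom has an end in its interior; a dipole is determined by the ends of
  -- any of its edges.
  have key : ∀ {A B : Sub G}, IsAtom G R A → IsAtom G R B → d ∈ A.darts → d ∈ B.darts →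
      ¬ IsDipole G A → A = B := by
    intro A B hA hB hdA hdB hd
    rcases S.src_not_mem_boundary_or hc hl hA hd hdA with h | h
    · exact S.atom_eq_of_interior hc hA hB (A.src_mem _ hdA) h (B.src_mem _ hdB)
    · exact S.atom_eq_of_interior hc hA hB (A.src_mem _ (A.inv_mem _ hdA)) h
        (B.src_mem _ (B.inv_mem _ hdB))
  by_cases hA' : IsDipole G A
  · by_cases hB' : IsDipole G B
    · have pair : ∀ {A : Sub G}, IsDipole G A → d ∈ A.darts →
          A = induced G {G.src d, G.src (G.inv d)} := by
        rintro A hA hd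
        obtain ⟨x, y, hxy, rfl⟩ := hA.exists_pair
        congr 1
        rcases hd with ⟨h₁ | h₁, h₂ | h₂⟩
        · exact absurd (h₂.trans h₁.symm) (hl d)
        · rw [h₁, h₂]
        · rw [h₁, h₂, Set.pair_comm]
        · exact absurd (h₂.trans h₁.symm) (hl d)
      rw [pair hA' hdA, ← pair hB' hdB]
    · exact (key hB hA hdB hdA hB').symm
  · exact key hA hB hdA hdB hA'

end Reduction

/-! ### Isomorphisms between subgraphs, as maps on the whole graph -/

section SubIso

variable {V : Type u} {D : Type v} {C : Type w} {G : ColGraph V D C}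

/-- The maps `f` and `g` restrict to an isomorphism from `A` to `B` that maps the boundary onto the
boundary. -/
structure SubIso (A B : Sub G) (f : V → V) (g : D → D) : Prop where
  bijV : Set.BijOn f A.verts B.verts
  bijD : Set.BijOn g A.darts B.darts
  src : ∀ d ∈ A.darts, G.src (g d) = f (G.src d)
  inv : ∀ d ∈ A.darts, G.inv (g d) = g (G.inv d)
  color : ∀ d ∈ A.darts, G.color (g d) = G.color d
  kind : ∀ d ∈ A.darts, G.kind (g d) = G.kind d
  boundary : ∀ x ∈ A.verts, f x ∈ boundary B ↔ x ∈ boundary A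

theorem exists_bijOn_of_equiv {α : Type*} {s t : Set α} (e : s ≃ t) :
    ∃ f : α → α, Set.BijOn f s t ∧ ∀ x (hx : x ∈ s), f x = e ⟨x, hx⟩ := by
  classical
  obtain ⟨f, key⟩ : ∃ f : α → α, ∀ x (hx : x ∈ s), f x = e ⟨x, hx⟩ :=
    ⟨fun x => if hx : x ∈ s then e ⟨x, hx⟩ else x, fun x hx => dif_pos hx⟩
  refine ⟨f, ⟨fun x hx => ?_, fun x hx y hy h => ?_, fun y hy => ?_⟩, key⟩
  · rw [key x hx]
    exact (e ⟨x, hx⟩).2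
  · rw [key x hx, key y hy] at h
    exact congrArg Subtype.val (e.injective (Subtype.ext h))
  · refine ⟨e.symm ⟨y, hy⟩, (e.symm ⟨y, hy⟩).2, ?_⟩
    rw [key _ (e.symm ⟨y, hy⟩).2]
    simp

theorem exists_bijOn_inverse {α : Type*} {s t : Set α} {f : α → α} (h : Set.BijOn f s t) :
    ∃ f' : α → α, Set.BijOn f' t s ∧ (∀ x ∈ s, f' (f x) = x) ∧ ∀ y ∈ t, f (f' y) = y := by
  obtain ⟨f', hf', hf⟩ := exists_bijOn_of_equiv (Set.BijOn.equiv f h).symm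
  have h₂ : ∀ y ∈ t, f (f' y) = y := by
    intro y hy
    rw [hf y hy]
    exact congrArg Subtype.val ((Set.BijOn.equiv f h).apply_symm_apply ⟨y, hy⟩)
  exact ⟨f', hf', fun x hx => h.injOn (hf'.mapsTo (h.mapsTo hx)) hx (h₂ _ (h.mapsTo hx)), h₂⟩

/-- Maps on all of G compose and restrict without transport along equations between subgraphs. -/
theorem exists_subIso {A B : Sub G} (F : Iso A.graph B.graph) (hF : MapsBoundary F) :
    ∃ f g, SubIso A B f g ∧ ∀ x (hx : x ∈ A.verts), f x = F.toV ⟨x, hx⟩ := by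
  obtain ⟨f, hf, hfF⟩ := exists_bijOn_of_equiv F.toV
  obtain ⟨g, hg, hgF⟩ := exists_bijOn_of_equiv F.toD
  refine ⟨f, g, ⟨hf, hg, ?_, ?_, ?_, ?_, ?_⟩, hfF⟩
  · intro d hd
    rw [hgF d hd, hfF _ (A.src_mem d hd)]
    exact congrArg Subtype.val (F.src_map ⟨d, hd⟩)
  · intro d hd
    rw [hgF d hd, hgF _ (A.inv_mem d hd)]
    exact congrArg Subtype.val (F.inv_map ⟨d, hd⟩)
  · intro d hd
    rw [hgF d hd]
    exact F.color_map ⟨d, hd⟩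
  · intro d hd
    rw [hgF d hd]
    exact F.kind_map ⟨d, hd⟩
  · intro x hx
    rw [hfF x hx]
    exact (hF ⟨x, hx⟩).symm

theorem SubIso.comp {A B E : Sub G} {f f' : V → V} {g g' : D → D} (h : SubIso A B f g)
    (h' : SubIso B E f' g') : SubIso A E (f' ∘ f) (g' ∘ g) where
  bijV := h'.bijV.comp h.bijV
  bijD := h'.bijD.comp h.bijD
  src d hd := (h'.src _ (h.bijD.mapsTo hd)).trans (congrArg f' (h.src d hd))
  inv d hd := (h'.inv _ (h.bijD.mapsTo hd)).trans (congrArg g' (h.inv d hd))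
  color d hd := (h'.color _ (h.bijD.mapsTo hd)).trans (h.color d hd)
  kind d hd := (h'.kind _ (h.bijD.mapsTo hd)).trans (h.kind d hd)
  boundary x hx := (h'.boundary _ (h.bijV.mapsTo hx)).trans (h.boundary x hx)

theorem SubIso.exists_symm {A B : Sub G} {f : V → V} {g : D → D} (h : SubIso A B f g) :
    ∃ f' g', SubIso B A f' g' ∧ (∀ x ∈ A.verts, f' (f x) = x) ∧ (∀ y ∈ B.verts, f (f' y) = y) ∧
      (∀ d ∈ A.darts, g' (g d) = d) ∧ ∀ e ∈ B.darts, g (g' e) = e := by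
  obtain ⟨f', hf', hf₁, hf₂⟩ := exists_bijOn_inverse h.bijV
  obtain ⟨g', hg', hg₁, hg₂⟩ := exists_bijOn_inverse h.bijD
  refine ⟨f', g', ⟨hf', hg', ?_, ?_, ?_, ?_, ?_⟩, hf₁, hf₂, hg₁, hg₂⟩
  · intro e he
    rw [← hf₁ _ (A.src_mem _ (hg'.mapsTo he)), ← h.src _ (hg'.mapsTo he), hg₂ e he]
  · intro e he
    rw [← hg₁ _ (A.inv_mem _ (hg'.mapsTo he)), ← h.inv _ (hg'.mapsTo he), hg₂ e he]
  · intro e he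
    rw [← h.color _ (hg'.mapsTo he), hg₂ e he]
  · intro e he
    rw [← h.kind _ (hg'.mapsTo he), hg₂ e he]
  · intro y hy
    rw [← h.boundary _ (hf'.mapsTo hy), hf₂ y hy]

theorem Sub.map_one (A : Sub G) : Sub.map 1 A = A :=
  Sub.ext (Set.image_id _) (Set.image_id _)

theorem Sub.map_mul (π ρ : Aut G) (A : Sub G) : Sub.map (π * ρ) A = Sub.map π (Sub.map ρ A) :=
  Sub.ext (Set.image_comp π.toV ρ.toV _) (Set.image_comp π.toD ρ.toD _)

theorem actV_one (x : V ⊕ Sub G) : actV 1 x = x := by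
  rcases x with x | A
  · rfl
  · exact congrArg Sum.inr (Sub.map_one A)

theorem actV_mul (π ρ : Aut G) (x : V ⊕ Sub G) : actV (π * ρ) x = actV π (actV ρ x) := by
  rcases x with x | A
  · rfl
  · exact congrArg Sum.inr (Sub.map_mul π ρ A)

theorem actD_one (d : D ⊕ (Sub G × (V ⊕ Sub G))) : actD 1 d = d := by
  rcases d with d | ⟨A, x⟩
  · rfl
  · exact congrArg Sum.inr (Prod.ext (Sub.map_one A) (actV_one x))

theorem actD_mul (π ρ : Aut G) (d : D ⊕ (Sub G × (V ⊕ Sub G))) :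
    actD (π * ρ) d = actD π (actD ρ d) := by
  rcases d with d | ⟨A, x⟩
  · rfl
  · exact congrArg Sum.inr (Prod.ext (Sub.map_mul π ρ A) (actV_mul π ρ x))

theorem mk_orbV_eq {Γ : Subgroup (Aut G)} {x y : V} :
    Quotient.mk (orbV Γ) x = Quotient.mk (orbV Γ) y ↔ ∃ π ∈ Γ, π.toV x = y :=
  Quotient.eq

theorem mk_orbD_eq {Γ : Subgroup (Aut G)} {d e : D} :
    Quotient.mk (orbD Γ) d = Quotient.mk (orbD Γ) e ↔ ∃ π ∈ Γ, π.toD d = e :=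
  Quotient.eq

end SubIso

namespace Reduction

variable {V : Type u} {D : Type v} {C : Type w} {V' : Type u} {D' : Type v}
  {G : ColGraph V D C} {R : Set V} {G' : ColGraph V' D' C}

/-! ### Images of automorphisms -/

theorem isImage_one (S : Reduction G R G') : S.IsImage 1 1 :=
  ⟨fun x => (actV_one (S.labelV x)).symm, fun d => (actD_one (S.labelD d)).symm⟩

theorem IsImage.mul {S : Reduction G R G'} {π ρ : Aut G} {π' ρ' : Aut G'} (h : S.IsImage π π')
    (k : S.IsImage ρ ρ') : S.IsImage (π * ρ) (π' * ρ') :=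
  ⟨fun x => by rw [actV_mul, ← k.1, ← h.1]; rfl, fun d => by rw [actD_mul, ← k.2, ← h.2]; rfl⟩

theorem IsImage.inv {S : Reduction G R G'} {π : Aut G} {π' : Aut G'} (h : S.IsImage π π') :
    S.IsImage π⁻¹ π'⁻¹ := by
  refine ⟨fun x => ?_, fun d => ?_⟩
  · obtain ⟨y, rfl⟩ := π'.toV.surjective x
    rw [h.1, ← actV_mul, inv_mul_cancel, actV_one]
    exact congrArg S.labelV (π'.toV.symm_apply_apply y)
  · obtain ⟨e, rfl⟩ := π'.toD.surjective d
    rw [h.2, ← actD_mul, inv_mul_cancel, actD_one]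
    exact congrArg S.labelD (π'.toD.symm_apply_apply e)

theorem IsImage.unique {S : Reduction G R G'} {π : Aut G} {π' ρ' : Aut G'} (h : S.IsImage π π')
    (k : S.IsImage π ρ') : π' = ρ' :=
  Iso.ext (Equiv.ext fun x => S.labelV_injective ((h.1 x).trans (k.1 x).symm))
    (Equiv.ext fun d => S.labelD_injective ((h.2 d).trans (k.2 d).symm))

theorem IsImage.labelV_inl {S : Reduction G R G'} {π : Aut G} {π' : Aut G'} (h : S.IsImage π π')
    {x' : V'} {x : V} (hx : S.labelV x' = Sum.inl x) :
    S.labelV (π'.toV x') = Sum.inl (π.toV x) := by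
  rw [h.1, hx]; rfl

theorem IsImage.labelD_inl {S : Reduction G R G'} {π : Aut G} {π' : Aut G'} (h : S.IsImage π π')
    {d' : D'} {d : D} (hd : S.labelD d' = Sum.inl d) :
    S.labelD (π'.toD d') = Sum.inl (π.toD d) := by
  rw [h.2, hd]; rfl

theorem IsImage.labelD_inr {S : Reduction G R G'} {π : Aut G} {π' : Aut G'} (h : S.IsImage π π')
    {d' : D'} {A : Sub G} {x : V ⊕ Sub G} (hd : S.labelD d' = Sum.inr (A, x)) :
    S.labelD (π'.toD d') = Sum.inr (Sub.map π A, actV π x) := by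
  rw [h.2, hd]; rfl

theorem IsImage.keptV {S : Reduction G R G'} {π : Aut G} {π' : Aut G'} (h : S.IsImage π π')
    {x : V} (hx : KeptV G R x) : KeptV G R (π.toV x) := by
  obtain ⟨x', hx'⟩ := S.exists_labelV_kept hx
  exact S.keptV_of_labelV (h.labelV_inl hx')

theorem IsImage.keptD {S : Reduction G R G'} {π : Aut G} {π' : Aut G'} (h : S.IsImage π π')
    {d : D} (hd : KeptD G R d) : KeptD G R (π.toD d) := by
  obtain ⟨d', hd'⟩ := S.exists_labelD_kept hd
  exact S.keptD_of_labelD (h.labelD_inl hd')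

/-- The automorphism π' carries a half-edge labelled by A to one labelled by `Sub.map π A`, and
labels of this form name atoms only. -/
theorem IsImage.isAtom {S : Reduction G R G'} (hc : G.simple.Connected) {π : Aut G} {π' : Aut G'}
    (h : S.IsImage π π') {A : Sub G} (hA : IsAtom G R A) : IsAtom G R (Sub.map π A) := by
  obtain ⟨b, hb⟩ := S.boundary_nonempty hc hA
  obtain ⟨d', hd'⟩ := S.exists_labelD_inl hA hb
  exact (S.isAtom_of_labelD (h.labelD_inr hd')).1

theorem extends_bot (S : Reduction G R G') : S.Extends ⊥ ⊥ := by
  refine ⟨?_, ?_⟩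
  · rintro π rfl
    exact ⟨1, Subgroup.mem_bot.2 rfl, S.isImage_one⟩
  · rintro π rfl
    exact ⟨1, Subgroup.mem_bot.2 rfl, S.isImage_one⟩

section Extends

variable {S : Reduction G R G'} {Γ : Subgroup (Aut G)} {Γ' : Subgroup (Aut G')}

theorem Extends.mk_orbV_eq_iff (h : S.Extends Γ Γ') {x' y' : V'} {x y : V}
    (hx : S.labelV x' = Sum.inl x) (hy : S.labelV y' = Sum.inl y) :
    Quotient.mk (orbV Γ) x = Quotient.mk (orbV Γ) y ↔
      Quotient.mk (orbV Γ') x' = Quotient.mk (orbV Γ') y' := by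
  rw [mk_orbV_eq, mk_orbV_eq]
  constructor
  · rintro ⟨π, hπ, rfl⟩
    obtain ⟨π', hπ', hi⟩ := h.1 π hπ
    exact ⟨π', hπ', S.labelV_injective ((hi.labelV_inl hx).trans hy.symm)⟩
  · rintro ⟨π', hπ', rfl⟩
    obtain ⟨π, hπ, hi⟩ := h.2 π' hπ'
    exact ⟨π, hπ, Sum.inl_injective ((hi.labelV_inl hx).symm.trans hy)⟩

theorem Extends.mk_orbD_eq_iff (h : S.Extends Γ Γ') {d' e' : D'} {d e : D}
    (hd : S.labelD d' = Sum.inl d) (he : S.labelD e' = Sum.inl e) :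
    Quotient.mk (orbD Γ) d = Quotient.mk (orbD Γ) e ↔
      Quotient.mk (orbD Γ') d' = Quotient.mk (orbD Γ') e' := by
  rw [mk_orbD_eq, mk_orbD_eq]
  constructor
  · rintro ⟨π, hπ, rfl⟩
    obtain ⟨π', hπ', hi⟩ := h.1 π hπ
    exact ⟨π', hπ', S.labelD_injective ((hi.labelD_inl hd).trans he.symm)⟩
  · rintro ⟨π', hπ', rfl⟩
    obtain ⟨π, hπ, hi⟩ := h.2 π' hπ'
    exact ⟨π, hπ, Sum.inl_injective ((hi.labelD_inl hd).symm.trans he)⟩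

end Extends

/-! ### The new edges -/

theorem exists_ends_eq_pair (S : Reduction G R G') (hc : G.simple.Connected) {A : Sub G}
    (hA : IsAtom G R A) : ∃ x y, ends G R A = {x, y} := by
  by_cases hb : IsBlockAtom G R A
  · obtain ⟨b, h⟩ := S.exists_boundary_eq_singleton hb
    refine ⟨Sum.inl b, Sum.inr A, Set.ext fun x => ?_⟩
    simp [ends, h, hb]
  · obtain ⟨x, y, -, h⟩ := S.exists_boundary_eq_pair hc hA hb
    refine ⟨Sum.inl x, Sum.inl y, Set.ext fun x => ?_⟩
    simp [ends, h, hb]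

/-- The ends of an atom form a pair, so its label occurs only on the two half-edges of its new edge.
-/
theorem eq_or_eq_inv (S : Reduction G R G') (hc : G.simple.Connected) {d' e' : D'} {A : Sub G}
    {x y : V ⊕ Sub G} (hd : S.labelD d' = Sum.inr (A, x)) (he : S.labelD e' = Sum.inr (A, y)) :
    e' = d' ∨ e' = G'.inv d' := by
  obtain ⟨-, z, hzx, hz⟩ := S.new_edge d' A x hd
  obtain ⟨a, b, hab⟩ := S.exists_ends_eq_pair hc (S.isAtom_of_labelD hd).1
  have hx := (S.isAtom_of_labelD hd).2
  have hy := (S.isAtom_of_labelD he).2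
  have hz' := (S.isAtom_of_labelD hz).2
  have : y = x ∨ y = z := by
    rw [hab] at hx hy hz'
    rcases hx with rfl | rfl <;> rcases hy with rfl | rfl <;> rcases hz' with rfl | rfl <;> simp_all
  rcases this with rfl | rfl
  · exact Or.inl (S.labelD_injective (he.trans hd.symm))
  · exact Or.inr (S.labelD_injective (he.trans hz.symm))

theorem exists_labelD_of_color_eq (S : Reduction G R G') {d' e' : D'} {A : Sub G} {x : V ⊕ Sub G}
    (hd : S.labelD d' = Sum.inr (A, x)) (h : G'.color d' = G'.color e') :
    ∃ B y, S.labelD e' = Sum.inr (B, y) := by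
  rcases he : S.labelD e' with e | ⟨B, y⟩
  · exact absurd (h.trans (S.kept e' e he).2.2.1).symm (S.new_color d' A x hd e)
  · exact ⟨B, y, rfl⟩

theorem eq_of_src_eq_pendant (S : Reduction G R G') {d' e' : D'} {A B : Sub G}
    (hd : S.labelD d' = Sum.inr (A, Sum.inr B)) (h : G'.src e' = G'.src d') : e' = d' := by
  have hsrc := (S.new_edge d' _ _ hd).1
  rw [← h] at hsrc
  obtain ⟨-, rfl⟩ := S.isBlockAtom_of_labelD hd
  rcases he : S.labelD e' with e | ⟨E, y⟩
  · rw [(S.kept e' e he).1] at hsrc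
    cases hsrc
  · rw [(S.new_edge e' _ _ he).1] at hsrc
    subst hsrc
    obtain ⟨-, rfl⟩ := S.isBlockAtom_of_labelD he
    exact S.labelD_injective (he.trans hd.symm)

/-- An edge at b outside of A either survives or lies in another atom that has b on its boundary. In
contrast to `eq_of_src_eq_pendant`, this tells the two ends of a new pendant edge apart. -/
theorem exists_ne_src_eq (S : Reduction G R G') {d' : D'} {A : Sub G} {b : V}
    (hd : S.labelD d' = Sum.inr (A, Sum.inl b)) (hA : IsBlockAtom G R A) :
    ∃ e', e' ≠ d' ∧ G'.src e' = G'.src d' := by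
  have hb := S.mem_boundary_of_labelD hd
  obtain ⟨e, he, hes⟩ := hb.2.resolve_left hA.2.2
  have hsrc := (S.new_edge d' _ _ hd).1
  by_cases hk : KeptD G R e
  · obtain ⟨e', he'⟩ := S.exists_labelD_kept hk
    refine ⟨e', ?_, S.labelV_injective ?_⟩
    · rintro rfl
      rw [hd] at he'
      cases he'
    · rw [(S.kept e' e he').1, hsrc, hes]
  · unfold KeptD at hk
    push Not at hk
    obtain ⟨B, hB, heB⟩ := hk
    have hbB : b ∈ boundary B := S.keptV_of_mem_boundary hA.1 hb B hB (hes ▸ B.src_mem e heB)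
    obtain ⟨e', he'⟩ := S.exists_labelD_inl hB hbB
    refine ⟨e', ?_, S.labelV_injective ?_⟩
    · rintro rfl
      rw [hd] at he'
      cases he'
      exact he heB
    · rw [(S.new_edge e' _ _ he').1, hsrc]

theorem isBlockAtom_iff_of_color_eq (S : Reduction G R G') (hc : G.simple.Connected) {d' e' : D'}
    {A B : Sub G} {x y : V ⊕ Sub G} (hd : S.labelD d' = Sum.inr (A, x))
    (he : S.labelD e' = Sum.inr (B, y)) (h : G'.color d' = G'.color e') :
    IsBlockAtom G R A ↔ IsBlockAtom G R B := by
  have hA := (S.isAtom_of_labelD hd).1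
  have hB := (S.isAtom_of_labelD he).1
  obtain ⟨F, hF⟩ := (S.color_iff d' A x e' B y hd he).1 h
  obtain ⟨f, g, hfg, -⟩ := exists_subIso F hF
  rw [S.isBlockAtom_iff hA (S.boundary_nonempty hc hA),
    S.isBlockAtom_iff hB (S.boundary_nonempty hc hB)]
  constructor
  · intro hs x hx y hy
    obtain ⟨x, hxA, rfl⟩ := hfg.bijV.surjOn hx.1
    obtain ⟨y, hyA, rfl⟩ := hfg.bijV.surjOn hy.1
    exact congrArg f (hs ((hfg.boundary x hxA).1 hx) ((hfg.boundary y hyA).1 hy))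
  · intro hs x hx y hy
    exact hfg.bijV.injOn hx.1 hy.1
      (hs ((hfg.boundary x hx.1).2 hx) ((hfg.boundary y hy.1).2 hy))

/-- Two half-edges of the same colour and kind that replace atoms come from atoms with an
isomorphism that matches the ends. -/
theorem exists_subIso_of_color_eq (S : Reduction G R G') (hc : G.simple.Connected) {d' e' : D'}
    {A B : Sub G} {x y : V} (hd : S.labelD d' = Sum.inr (A, Sum.inl x))
    (he : S.labelD e' = Sum.inr (B, Sum.inl y)) (hcol : G'.color d' = G'.color e')
    (hkind : G'.kind d' = G'.kind e') : ∃ f g, SubIso A B f g ∧ f x = y := by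
  have hA := (S.isAtom_of_labelD hd).1
  have hB := (S.isAtom_of_labelD he).1
  have hx := S.mem_boundary_of_labelD hd
  have hy := S.mem_boundary_of_labelD he
  obtain ⟨F, hF⟩ := (S.color_iff d' A _ e' B _ hd he).1 hcol
  have hFx : (F.toV ⟨x, hx.1⟩).1 ∈ boundary B := (hF ⟨x, hx.1⟩).1 hx
  by_cases hFy : (F.toV ⟨x, hx.1⟩).1 = y
  · obtain ⟨f, g, hfg, hf⟩ := exists_subIso F hF
    exact ⟨f, g, hfg, (hf x hx.1).trans hFy⟩
  -- F hits the wrong end, so B has two boundary vertices.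
  have hbB : ¬ IsBlockAtom G R B := fun h =>
    hFy ((S.isBlockAtom_iff hB (S.boundary_nonempty hc hB)).1 h hFx hy)
  have hbA : ¬ IsBlockAtom G R A := fun h => hbB ((S.isBlockAtom_iff_of_color_eq hc hd he hcol).1 h)
  have two : ∀ z ∈ boundary B, z ≠ (F.toV ⟨x, hx.1⟩).1 → z = y := by
    intro z hz hzx
    obtain ⟨a, b, -, hab⟩ := S.exists_boundary_eq_pair hc hB hbB
    rw [hab] at hz hy hFx
    rcases hz with hz | hz <;> rcases hy with hy | hy <;> rcases hFx with hFx | hFx <;>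
      simp_all
  by_cases hs : IsSwappable A
  · obtain ⟨τ, hτ⟩ := hs
    -- Exchanging the ends of A first makes F send x to the right end.
    have hτF : MapsBoundary (Iso.trans τ F) := by
      intro z
      refine Iff.trans ⟨fun hz => (hτ z hz).1, fun hz => ?_⟩ (hF (τ.toV z))
      obtain ⟨a, b, hab, hbd⟩ := S.exists_boundary_eq_pair hc hA hbA
      have ha : a ∈ boundary A := hbd ▸ Or.inl rfl
      have hb : b ∈ boundary A := hbd ▸ Or.inr rfl
      have hτa := hτ ⟨a, ha.1⟩ ha
      have hτb := hτ ⟨b, hb.1⟩ hb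
      have h₁ : τ.toV ⟨a, ha.1⟩ = ⟨b, hb.1⟩ := by
        have h := hτa.1
        rw [hbd] at h
        exact Subtype.ext (h.resolve_left fun h => hτa.2 (Subtype.ext h))
      have h₂ : τ.toV ⟨b, hb.1⟩ = ⟨a, ha.1⟩ := by
        have h := hτb.1
        rw [hbd] at h
        exact Subtype.ext (h.resolve_right fun h => hτb.2 (Subtype.ext h))
      rw [hbd] at hz
      rcases hz with hz | hz
      · have : τ.toV z = τ.toV ⟨b, hb.1⟩ := by rw [h₂]; exact Subtype.ext hz
        rw [τ.toV.injective this]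
        exact hb
      · have : τ.toV z = τ.toV ⟨a, ha.1⟩ := by rw [h₁]; exact Subtype.ext hz
        rw [τ.toV.injective this]
        exact ha
    obtain ⟨f, g, hfg, hf⟩ := exists_subIso _ hτF
    refine ⟨f, g, hfg, ?_⟩
    rw [hf x hx.1]
    refine two _ ((hτF ⟨x, hx.1⟩).1 hx) fun h => (hτ ⟨x, hx.1⟩ hx).2 ?_
    exact F.toV.injective (Subtype.ext h)
  -- For asymmetric atoms, F forces d' to have the kind of the half-edge opposite to e', hence the
  -- opposite of its own kind; a directed half-edge cannot have that.
  · exfalso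
    obtain ⟨-, z, hz, hinv⟩ := S.new_edge e' _ _ he
    have hz' : z = Sum.inl (F.toV ⟨x, hx.1⟩).1 := by
      obtain ⟨a', ha'⟩ := S.exists_labelD_inl hB hFx
      rcases S.eq_or_eq_inv hc he ha' with rfl | rfl
      · rw [he] at ha'
        exact absurd (by simpa using ha') (Ne.symm hFy)
      · rw [hinv] at ha'
        simpa using ha'
    rw [hz'] at hinv
    have h₁ := S.consistent d' (G'.inv e') A B F ⟨x, hx.1⟩ hd hinv hF hbA hs
    rw [G'.kind_inv, ← hkind] at h₁
    rcases S.kind_asymmetric d' _ _ hd hbA hs with h | h <;> rw [h] at h₁ <;> cases h₁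

end Reduction

/-- The relation need only reach every class on either side, so it may be specified on chosen
representatives. The two directions of `hiff` give that the map is well defined and injective. -/
theorem exists_equiv_of_rel {α β : Type*} (s : Setoid α) (t : Setoid β) (rel : α → β → Prop)
    (htot : ∀ x, ∃ x₂ y, Quotient.mk s x = Quotient.mk s x₂ ∧ rel x₂ y)
    (hsurj : ∀ y, ∃ y₂ x, Quotient.mk t y = Quotient.mk t y₂ ∧ rel x y₂)
    (hiff : ∀ x y x₂ y₂, rel x y → rel x₂ y₂ →
      (Quotient.mk s x = Quotient.mk s x₂ ↔ Quotient.mk t y = Quotient.mk t y₂)) :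
    ∃ e : Quotient s ≃ Quotient t, ∀ x y, rel x y → e (Quotient.mk s x) = Quotient.mk t y := by
  have hex : ∀ q : Quotient s, ∃ p : Quotient t, ∃ x y, rel x y ∧ Quotient.mk s x = q ∧
      Quotient.mk t y = p := by
    rintro ⟨x⟩
    obtain ⟨x₂, y, hx, hr⟩ := htot x
    exact ⟨_, x₂, y, hr, hx.symm, rfl⟩
  choose f hf using hex
  have key : ∀ x y, rel x y → f (Quotient.mk s x) = Quotient.mk t y := by
    intro x y hr
    obtain ⟨x₂, y₂, hr₂, hx, hy⟩ := hf (Quotient.mk s x)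
    rw [← hy]
    exact (hiff _ _ _ _ hr₂ hr).1 hx
  refine ⟨Equiv.ofBijective f ⟨fun q q₂ h => ?_, ?_⟩, key⟩
  · obtain ⟨x, y, hr, rfl, hy⟩ := hf q
    obtain ⟨x₂, y₂, hr₂, rfl, hy₂⟩ := hf q₂
    exact (hiff _ _ _ _ hr hr₂).2 ((hy.trans h).trans hy₂.symm)
  · rintro ⟨y⟩
    obtain ⟨y₂, x, hy, hr⟩ := hsurj y
    exact ⟨Quotient.mk s x, (key x y₂ hr).trans hy.symm⟩

/-! ### Isomorphisms of quotients, read off on representatives -/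

section QuotIso

variable {V : Type u} {D : Type v} {C : Type w} {G : ColGraph V D C} {Γ Δ : Subgroup (Aut G)}
  (ψ : Iso (quot G Γ) (quot G Δ))

theorem Iso.color_eq_of_mk {d e : D}
    (h : ψ.toD (Quotient.mk (orbD Γ) d) = Quotient.mk (orbD Δ) e) : G.color d = G.color e := by
  have := ψ.color_map (Quotient.mk (orbD Γ) d)
  rw [h] at this
  exact this.symm

theorem Iso.kind_eq_of_mk {d e : D}
    (h : ψ.toD (Quotient.mk (orbD Γ) d) = Quotient.mk (orbD Δ) e) : G.kind d = G.kind e := by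
  have := ψ.kind_map (Quotient.mk (orbD Γ) d)
  rw [h] at this
  exact this.symm

theorem Iso.src_mk {d e : D} (h : ψ.toD (Quotient.mk (orbD Γ) d) = Quotient.mk (orbD Δ) e) :
    ψ.toV (Quotient.mk (orbV Γ) (G.src d)) = Quotient.mk (orbV Δ) (G.src e) := by
  have := ψ.src_map (Quotient.mk (orbD Γ) d)
  rw [h] at this
  exact this.symm

theorem Iso.inv_mk {d e : D} (h : ψ.toD (Quotient.mk (orbD Γ) d) = Quotient.mk (orbD Δ) e) :
    ψ.toD (Quotient.mk (orbD Γ) (G.inv d)) = Quotient.mk (orbD Δ) (G.inv e) := by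
  have := ψ.inv_map (Quotient.mk (orbD Γ) d)
  rw [h] at this
  exact this.symm

end QuotIso

/-! ### Matching atoms along an isomorphism of quotients, and gluing -/

namespace Reduction

variable {V : Type u} {D : Type v} {C : Type w} {V' : Type u} {D' : Type v}
  {G : ColGraph V D C} {R : Set V} {G' : ColGraph V' D' C}
  {Γ Δ : Subgroup (Aut G)} {Γ' Δ' : Subgroup (Aut G')}

/-- An isomorphism of quotients maps the half-edges at the boundary of atoms to such half-edges, and
not to half-edges at new pendant vertices. -/
theorem exists_labelD_inl_of_mk (S : Reduction G R G') (hc : G.simple.Connected)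
    (hΓ' : Semiregular G' Γ') (ψ : Iso (quot G' Γ') (quot G' Δ')) {d' e' : D'}
    (h : ψ.toD (Quotient.mk (orbD Γ') d') = Quotient.mk (orbD Δ') e') {A : Sub G} {b : V}
    (hd : S.labelD d' = Sum.inr (A, Sum.inl b)) :
    ∃ B c, S.labelD e' = Sum.inr (B, Sum.inl c) := by
  have hcol := ψ.color_eq_of_mk h
  obtain ⟨B, c | E, he⟩ := S.exists_labelD_of_color_eq hd hcol
  · exact ⟨B, c, he⟩
  exfalso
  have hA := (S.isBlockAtom_iff_of_color_eq hc hd he hcol).2 (S.isBlockAtom_of_labelD he).1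
  -- If d' went to a pendant end, so would a second half-edge f' at the same vertex, and a single
  -- half-edge is attached there. Then an element of Γ' takes f' to d' and fixes their vertex, hence
  -- is the identity.
  obtain ⟨f', hne, hsrc⟩ := S.exists_ne_src_eq hd hA
  obtain ⟨g', hg⟩ := Quotient.exists_rep (ψ.toD (Quotient.mk (orbD Γ') f'))
  have h₁ := ψ.src_mk hg.symm
  rw [hsrc, ψ.src_mk h] at h₁
  obtain ⟨δ, hδ, hδg⟩ := mk_orbV_eq.1 h₁.symm
  have h₂ : δ.toD g' = e' := S.eq_of_src_eq_pendant he ((δ.src_map g').trans hδg)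
  have h₃ : ψ.toD (Quotient.mk (orbD Γ') f') = ψ.toD (Quotient.mk (orbD Γ') d') := by
    rw [← hg, h]
    exact mk_orbD_eq.2 ⟨δ, hδ, h₂⟩
  obtain ⟨γ, hγ, hγf⟩ := mk_orbD_eq.1 (ψ.toD.injective h₃)
  have hγ1 : γ = 1 := by
    by_contra hne1
    refine (hΓ' γ hγ hne1).1 (G'.src f') ?_
    rw [← γ.src_map, hγf, hsrc]
  subst hγ1
  exact hne hγf

theorem exists_labelD_kept_of_mk (S : Reduction G R G') (ψ : Iso (quot G' Γ') (quot G' Δ'))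
    {d' e' : D'} (h : ψ.toD (Quotient.mk (orbD Γ') d') = Quotient.mk (orbD Δ') e') {d : D}
    (hd : S.labelD d' = Sum.inl d) : ∃ e, S.labelD e' = Sum.inl e := by
  rcases he : S.labelD e' with e | ⟨B, y⟩
  · exact ⟨e, rfl⟩
  · obtain ⟨A, x, hA⟩ := S.exists_labelD_of_color_eq he (ψ.color_eq_of_mk h).symm
    rw [hd] at hA
    cases hA

/-- Pulling back the half-edge at a new pendant vertex gives again a pendant one, and its vertex
would share an orbit with a common vertex; but elements of Γ' map common vertices to common ones. -/
theorem exists_labelV_kept_of_mk (S : Reduction G R G') (hc : G.simple.Connected)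
    (hE : S.Extends Γ Γ') (hΓ' : Semiregular G' Γ')
    (ψ : Iso (quot G' Γ') (quot G' Δ')) {x' y' : V'}
    (h : ψ.toV (Quotient.mk (orbV Γ') x') = Quotient.mk (orbV Δ') y') {x : V}
    (hx : S.labelV x' = Sum.inl x) : ∃ y, S.labelV y' = Sum.inl y := by
  rcases hy : S.labelV y' with y | B
  · exact ⟨y, rfl⟩
  exfalso
  have hB := S.isBlockAtom_of_labelV hy
  obtain ⟨e', he⟩ := S.exists_labelD hB.1 (Or.inr ⟨hB, rfl⟩)
  obtain rfl : G'.src e' = y' := S.labelV_injective ((S.new_edge e' _ _ he).1.trans hy.symm)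
  obtain ⟨d', hd⟩ := Quotient.exists_rep (ψ.symm.toD (Quotient.mk (orbD Δ') e'))
  have hψ : ψ.toD (Quotient.mk (orbD Γ') d') = Quotient.mk (orbD Δ') e' :=
    (Equiv.eq_symm_apply ψ.toD).1 hd
  obtain ⟨A, z, hA⟩ := S.exists_labelD_of_color_eq he (ψ.color_eq_of_mk hψ).symm
  rcases z with b | A'
  · obtain ⟨_, _, h'⟩ := S.exists_labelD_inl_of_mk hc hΓ' ψ hψ hA
    rw [he] at h'
    cases h'
  · have h₁ := ψ.src_mk hψ
    rw [← h] at h₁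
    obtain ⟨γ', hγ', hγ⟩ := mk_orbV_eq.1 (ψ.toV.injective h₁).symm
    obtain ⟨γ, -, hi⟩ := hE.2 γ' hγ'
    have h₂ := hi.labelV_inl hx
    rw [hγ, (S.new_edge d' _ _ hA).1] at h₂
    cases h₂

/-- The isomorphisms `f A`, `g A` from the atoms `A` in `T` to the atoms `F A` match the
isomorphism `ψ` at the ends of the new edges. -/
structure Matching (S : Reduction G R G') (ψ : Iso (quot G' Γ') (quot G' Δ')) (T : Set (Sub G))
    (F : Sub G → Sub G) (f : Sub G → V → V) (g : Sub G → D → D) : Prop where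
  subIso : ∀ A ∈ T, SubIso A (F A) (f A) (g A)
  ends : ∀ A ∈ T, ∀ d' b, S.labelD d' = Sum.inr (A, Sum.inl b) →
    ∃ e', S.labelD e' = Sum.inr (F A, Sum.inl (f A b)) ∧
      ψ.toD (Quotient.mk (orbD Γ') d') = Quotient.mk (orbD Δ') e'

/-- The other end carries the opposite half-edge, and ψ commutes with passing to it. -/
theorem ends_of_one_end (S : Reduction G R G') (hc : G.simple.Connected)
    (ψ : Iso (quot G' Γ') (quot G' Δ')) {A B : Sub G} {f : V → V} {g : D → D}
    (hfg : SubIso A B f g) {d' e' : D'} {x : V}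
    (hd : S.labelD d' = Sum.inr (A, Sum.inl x)) (he : S.labelD e' = Sum.inr (B, Sum.inl (f x)))
    (h : ψ.toD (Quotient.mk (orbD Γ') d') = Quotient.mk (orbD Δ') e') {d₂ : D'} {b : V}
    (hd₂ : S.labelD d₂ = Sum.inr (A, Sum.inl b)) :
    ∃ e₂, S.labelD e₂ = Sum.inr (B, Sum.inl (f b)) ∧
      ψ.toD (Quotient.mk (orbD Γ') d₂) = Quotient.mk (orbD Δ') e₂ := by
  rcases S.eq_or_eq_inv hc hd hd₂ with rfl | rfl
  · rw [hd] at hd₂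
    cases hd₂
    exact ⟨e', he, h⟩
  · have hx := S.mem_boundary_of_labelD hd
    have hb := S.mem_boundary_of_labelD hd₂
    have hbx : b ≠ x := by
      rintro rfl
      obtain ⟨-, y, hy, hy'⟩ := S.new_edge d' _ _ hd
      rw [hd₂] at hy'
      cases hy'
      exact hy rfl
    obtain ⟨e₂, he₂⟩ := S.exists_labelD_inl (S.isAtom_of_labelD he).1
      ((hfg.boundary b hb.1).2 hb)
    rcases S.eq_or_eq_inv hc he he₂ with rfl | rfl
    · rw [he] at he₂
      have : f x = f b := by simpa using he₂
      exact absurd (hfg.bijV.injOn hx.1 hb.1 this).symm hbx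
    · exact ⟨_, he₂, ψ.inv_mk h⟩

section Gluing

variable {S : Reduction G R G'} {ψ : Iso (quot G' Γ') (quot G' Δ')} {T : Set (Sub G)}
  {F : Sub G → Sub G} {f : Sub G → V → V} {g : Sub G → D → D}

theorem Matching.isAtom (M : S.Matching ψ T F f g) (hc : G.simple.Connected) {A : Sub G}
    (hA : A ∈ T) (hA' : IsAtom G R A) : IsAtom G R (F A) := by
  obtain ⟨b, hb⟩ := S.boundary_nonempty hc hA'
  obtain ⟨d', hd⟩ := S.exists_labelD_inl hA' hb
  obtain ⟨e', he, -⟩ := M.ends A hA d' b hd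
  exact (S.isAtom_of_labelD he).1

/-- Pull a new half-edge of B back along ψ, move its atom into T by Γ, and compare images: they
differ by an element of Δ'. -/
theorem Matching.exists_map_eq (M : S.Matching ψ T F f g) (hc : G.simple.Connected)
    (hE : S.Extends Γ Γ') (hE' : S.Extends Δ Δ') (hΔ' : Semiregular G' Δ')
    (hT' : ∀ A, IsAtom G R A → ∃ γ ∈ Γ, Sub.map γ A ∈ T) {B : Sub G} (hB : IsAtom G R B) :
    ∃ A ∈ T, ∃ δ ∈ Δ, Sub.map δ B = F A := by
  obtain ⟨c, hcB⟩ := S.boundary_nonempty hc hB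
  obtain ⟨e', he⟩ := S.exists_labelD_inl hB hcB
  obtain ⟨d', hd⟩ := Quotient.exists_rep (ψ.symm.toD (Quotient.mk (orbD Δ') e'))
  obtain ⟨A, b, hA⟩ := S.exists_labelD_inl_of_mk hc hΔ' ψ.symm hd.symm he
  have hψ : ψ.toD (Quotient.mk (orbD Γ') d') = Quotient.mk (orbD Δ') e' :=
    (Equiv.eq_symm_apply ψ.toD).1 hd
  obtain ⟨γ, hγ, hγA⟩ := hT' A (S.isAtom_of_labelD hA).1
  obtain ⟨γ', hγ', hi⟩ := hE.1 γ hγ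
  obtain ⟨e₂, he₂, hψ₂⟩ := M.ends _ hγA _ _ (hi.labelD_inr hA)
  have : Quotient.mk (orbD Γ') d' = Quotient.mk (orbD Γ') (γ'.toD d') :=
    mk_orbD_eq.2 ⟨γ', hγ', rfl⟩
  rw [← this, hψ] at hψ₂
  obtain ⟨δ', hδ', rfl⟩ := mk_orbD_eq.1 hψ₂
  obtain ⟨δ, hδ, hj⟩ := hE'.2 δ' hδ'
  rw [hj.labelD_inr he] at he₂
  refine ⟨_, hγA, δ, hδ, ?_⟩
  exact (Prod.mk.inj (Sum.inr_injective he₂)).1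

/-- New edges of target atoms in one Δ-orbit pull back along ψ to edges in one Γ'-orbit, and T has
one atom for each Γ-orbit. -/
theorem Matching.eq_of_map_eq (M : S.Matching ψ T F f g) (hc : G.simple.Connected)
    (hE : S.Extends Γ Γ') (hE' : S.Extends Δ Δ') (hT : ∀ A ∈ T, IsAtom G R A)
    (hfreeT : ∀ A ∈ T, ∀ γ ∈ Γ, Sub.map γ A ∈ T → γ = 1)
    (hfree : ∀ B, IsAtom G R B → ∀ δ ∈ Δ, Sub.map δ B = B → δ = 1) {A A₂ : Sub G} (hA : A ∈ T)
    (hA₂ : A₂ ∈ T) {δ : Aut G} (hδ : δ ∈ Δ) (h : Sub.map δ (F A) = F A₂) : A = A₂ ∧ δ = 1 := by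
  have key : A = A₂ := by
    obtain ⟨b, hb⟩ := S.boundary_nonempty hc (hT A hA)
    obtain ⟨b₂, hb₂⟩ := S.boundary_nonempty hc (hT A₂ hA₂)
    obtain ⟨d', hd⟩ := S.exists_labelD_inl (hT A hA) hb
    obtain ⟨d₂, hd₂⟩ := S.exists_labelD_inl (hT A₂ hA₂) hb₂
    obtain ⟨e', he, hψ⟩ := M.ends A hA d' b hd
    obtain ⟨e₂, he₂, hψ₂⟩ := M.ends A₂ hA₂ d₂ b₂ hd₂
    obtain ⟨δ', hδ', hi⟩ := hE'.1 δ hδ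
    have he' := hi.labelD_inr he
    rw [h] at he'
    have hmk : Quotient.mk (orbD Δ') e' = Quotient.mk (orbD Δ') (δ'.toD e') :=
      mk_orbD_eq.2 ⟨δ', hδ', rfl⟩
    have : ∃ d₃ z, S.labelD d₃ = Sum.inr (A₂, z) ∧
        Quotient.mk (orbD Γ') d' = Quotient.mk (orbD Γ') d₃ := by
      -- δ' may match the chosen end of one atom with either end of the other.
      rcases S.eq_or_eq_inv hc he₂ he' with h' | h'
      · refine ⟨d₂, _, hd₂, ψ.toD.injective ?_⟩
        rw [hψ, hψ₂, hmk, h']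
      · obtain ⟨-, z, -, hz⟩ := S.new_edge d₂ _ _ hd₂
        refine ⟨G'.inv d₂, z, hz, ψ.toD.injective ?_⟩
        rw [hψ, ψ.inv_mk hψ₂, hmk, h']
    obtain ⟨d₃, z, hd₃, hmk₃⟩ := this
    obtain ⟨γ', hγ', rfl⟩ := mk_orbD_eq.1 hmk₃
    obtain ⟨γ, hγ, hj⟩ := hE.2 γ' hγ'
    rw [hj.labelD_inr hd] at hd₃
    have hγA : Sub.map γ A = A₂ := (Prod.mk.inj (Sum.inr_injective hd₃)).1
    have hγ1 := hfreeT A hA γ hγ (hγA ▸ hA₂)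
    rw [hγ1, Sub.map_one] at hγA
    exact hγA
  subst key
  exact ⟨rfl, hfree _ (M.isAtom hc hA (hT A hA)) δ hδ h⟩

theorem exists_interior_of_not_keptV {x : V} (h : ¬ KeptV G R x) :
    ∃ A, IsAtom G R A ∧ x ∈ A.verts ∧ x ∉ boundary A := by
  unfold KeptV at h
  push Not at h
  exact h

theorem exists_mem_of_not_keptD {d : D} (h : ¬ KeptD G R d) :
    ∃ A, IsAtom G R A ∧ d ∈ A.darts := by
  unfold KeptD at h
  push Not at h
  exact h

/-- An isomorphism of the quotients of the reduced graph and isomorphisms of atoms that match it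
together give an isomorphism of the quotients of the original graph. -/
theorem Matching.exists_iso (M : S.Matching ψ T F f g) (hc : G.simple.Connected)
    (hl : ∀ d, G.src (G.inv d) ≠ G.src d)
    (hE : S.Extends Γ Γ') (hE' : S.Extends Δ Δ') (hΓ' : Semiregular G' Γ')
    (hΔ' : Semiregular G' Δ') (hT : ∀ A ∈ T, IsAtom G R A)
    (hT' : ∀ A, IsAtom G R A → ∃ γ ∈ Γ, Sub.map γ A ∈ T)
    (hfreeT : ∀ A ∈ T, ∀ γ ∈ Γ, Sub.map γ A ∈ T → γ = 1)
    (hfree : ∀ B, IsAtom G R B → ∀ δ ∈ Δ, Sub.map δ B = B → δ = 1) :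
    ∃ φ : Iso (quot G Γ) (quot G Δ), S.Agree φ ψ ∧ ∀ A ∈ T,
      (∀ x ∈ A.verts,
        φ.toV (Quotient.mk (orbV Γ) x) = Quotient.mk (orbV Δ) (f A x)) ∧
      ∀ d ∈ A.darts, φ.toD (Quotient.mk (orbD Γ) d) = Quotient.mk (orbD Δ) (g A d) := by
  -- The desired map: ψ on the common part, and the chosen isomorphisms in the interiors of the
  -- representatives in T.
  let relV : V → V → Prop := fun x y =>
    (∃ x' y', S.labelV x' = Sum.inl x ∧ S.labelV y' = Sum.inl y ∧
      ψ.toV (Quotient.mk (orbV Γ') x') = Quotient.mk (orbV Δ') y') ∨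
    ∃ A ∈ T, x ∈ A.verts ∧ x ∉ boundary A ∧ f A x = y
  let relD : D → D → Prop := fun d e =>
    (∃ d' e', S.labelD d' = Sum.inl d ∧ S.labelD e' = Sum.inl e ∧
      ψ.toD (Quotient.mk (orbD Γ') d') = Quotient.mk (orbD Δ') e') ∨
    ∃ A ∈ T, d ∈ A.darts ∧ g A d = e
  -- At boundary vertices the two descriptions agree, because the isomorphisms match ψ at the ends.
  have hrelA : ∀ A ∈ T, ∀ x ∈ A.verts, relV x (f A x) := by
    intro A hA x hx
    by_cases hb : x ∈ boundary A
    · obtain ⟨d', hd⟩ := S.exists_labelD_inl (hT A hA) hb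
      obtain ⟨e', he, hψ⟩ := M.ends A hA d' x hd
      exact Or.inl ⟨_, _, (S.new_edge d' _ _ hd).1, (S.new_edge e' _ _ he).1, ψ.src_mk hψ⟩
    · exact Or.inr ⟨A, hA, hx, hb, rfl⟩
  have hsrc : ∀ d e, relD d e → relV (G.src d) (G.src e) := by
    rintro d e (⟨d', e', hd, he, hψ⟩ | ⟨A, hA, hd, rfl⟩)
    · exact Or.inl ⟨_, _, (S.kept d' d hd).1, (S.kept e' e he).1, ψ.src_mk hψ⟩
    · rw [(M.subIso A hA).src d hd]
      exact hrelA A hA _ (A.src_mem d hd)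
  have hinv : ∀ d e, relD d e → relD (G.inv d) (G.inv e) := by
    rintro d e (⟨d', e', hd, he, hψ⟩ | ⟨A, hA, hd, rfl⟩)
    · exact Or.inl ⟨_, _, (S.kept d' d hd).2.1, (S.kept e' e he).2.1, ψ.inv_mk hψ⟩
    · exact Or.inr ⟨A, hA, A.inv_mem d hd, ((M.subIso A hA).inv d hd).symm⟩
  have hcolkind : ∀ d e, relD d e → G.color e = G.color d ∧ G.kind e = G.kind d := by
    rintro d e (⟨d', e', hd, he, hψ⟩ | ⟨A, hA, hd, rfl⟩)
    · obtain ⟨-, -, h₁, h₂⟩ := S.kept d' d hd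
      obtain ⟨-, -, h₃, h₄⟩ := S.kept e' e he
      rw [← h₁, ← h₂, ← h₃, ← h₄]
      exact ⟨(ψ.color_eq_of_mk hψ).symm, (ψ.kind_eq_of_mk hψ).symm⟩
    · exact ⟨(M.subIso A hA).color d hd, (M.subIso A hA).kind d hd⟩
  have hnotkept : ∀ A, IsAtom G R A → ∀ x ∈ A.verts, x ∉ boundary A → ¬ KeptV G R x :=
    fun A hA x hx hb hk => hb (hk A hA hx)
  have hint : ∀ A ∈ T, ∀ x ∈ A.verts, x ∉ boundary A →
      f A x ∈ (F A).verts ∧ f A x ∉ boundary (F A) := fun A hA x hx hb =>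
    ⟨(M.subIso A hA).bijV.mapsTo hx, fun h => hb (((M.subIso A hA).boundary x hx).1 h)⟩
  have hmap : ∀ A ∈ T, ∀ A₂ ∈ T, ∀ γ ∈ Γ, Sub.map γ A = A₂ → A = A₂ ∧ γ = 1 := by
    rintro A hA _ hA₂ γ hγ rfl
    obtain rfl := hfreeT A hA γ hγ hA₂
    exact ⟨(Sub.map_one A).symm, rfl⟩
  obtain ⟨eV, heV⟩ : ∃ e : Quotient (orbV Γ) ≃ Quotient (orbV Δ),
      ∀ x y, relV x y → e (Quotient.mk (orbV Γ) x) = Quotient.mk (orbV Δ) y := by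
    refine exists_equiv_of_rel _ _ relV ?_ ?_ ?_
    · intro x
      by_cases hx : KeptV G R x
      · obtain ⟨x', hx'⟩ := S.exists_labelV_kept hx
        obtain ⟨y', hy'⟩ := Quotient.exists_rep (ψ.toV (Quotient.mk (orbV Γ') x'))
        obtain ⟨y, hy⟩ := S.exists_labelV_kept_of_mk hc hE hΓ' ψ hy'.symm hx'
        exact ⟨x, y, rfl, Or.inl ⟨x', y', hx', hy, hy'.symm⟩⟩
      · obtain ⟨A, hA, hxA, -⟩ := exists_interior_of_not_keptV hx
        obtain ⟨γ, hγ, hγA⟩ := hT' A hA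
        exact ⟨γ.toV x, _, mk_orbV_eq.2 ⟨γ, hγ, rfl⟩, hrelA _ hγA _ ⟨x, hxA, rfl⟩⟩
    · intro y
      by_cases hy : KeptV G R y
      · obtain ⟨y', hy'⟩ := S.exists_labelV_kept hy
        obtain ⟨x', hx'⟩ := Quotient.exists_rep (ψ.symm.toV (Quotient.mk (orbV Δ') y'))
        obtain ⟨x, hx⟩ := S.exists_labelV_kept_of_mk hc hE' hΔ' ψ.symm hx'.symm hy'
        exact ⟨y, x, rfl, Or.inl ⟨x', y', hx, hy', (Equiv.eq_symm_apply ψ.toV).1 hx'⟩⟩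
      · obtain ⟨B, hB, hyB, -⟩ := exists_interior_of_not_keptV hy
        obtain ⟨A, hA, δ, hδ, hδB⟩ := M.exists_map_eq hc hE hE' hΔ' hT' hB
        have : δ.toV y ∈ (F A).verts := hδB ▸ ⟨y, hyB, rfl⟩
        obtain ⟨x, hx, hxy⟩ := (M.subIso A hA).bijV.surjOn this
        exact ⟨δ.toV y, x, mk_orbV_eq.2 ⟨δ, hδ, rfl⟩, hxy ▸ hrelA A hA x hx⟩
    -- Common and interior vertices never share an orbit, so the two clauses do not interfere.
    · have mixed : ∀ x y x₂ y₂, (∃ x' y', S.labelV x' = Sum.inl x ∧ S.labelV y' = Sum.inl y ∧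
            ψ.toV (Quotient.mk (orbV Γ') x') = Quotient.mk (orbV Δ') y') →
          (∃ A ∈ T, x₂ ∈ A.verts ∧ x₂ ∉ boundary A ∧ f A x₂ = y₂) →
          Quotient.mk (orbV Γ) x ≠ Quotient.mk (orbV Γ) x₂ ∧
            Quotient.mk (orbV Δ) y ≠ Quotient.mk (orbV Δ) y₂ := by
        rintro x y x₂ _ ⟨x', y', hx, hy, -⟩ ⟨A, hA, hxA, hxb, rfl⟩
        refine ⟨fun h => ?_, fun h => ?_⟩
        · obtain ⟨γ, hγ, rfl⟩ := mk_orbV_eq.1 h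
          obtain ⟨γ', -, hi⟩ := hE.1 γ hγ
          exact hnotkept A (hT A hA) _ hxA hxb (hi.keptV (S.keptV_of_labelV hx))
        · obtain ⟨δ, hδ, hδy⟩ := mk_orbV_eq.1 h
          obtain ⟨δ', -, hi⟩ := hE'.1 δ hδ
          obtain ⟨h₁, h₂⟩ := hint A hA x₂ hxA hxb
          exact hnotkept _ (M.isAtom hc hA (hT A hA)) _ h₁ h₂
            (hδy ▸ hi.keptV (S.keptV_of_labelV hy))
      rintro x y x₂ y₂ (hk | hA) (hk₂ | hA₂)
      · obtain ⟨x', y', hx, hy, hψ⟩ := hk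
        obtain ⟨x₂', y₂', hx₂, hy₂, hψ₂⟩ := hk₂
        rw [hE.mk_orbV_eq_iff hx hx₂, hE'.mk_orbV_eq_iff hy hy₂, ← hψ, ← hψ₂,
          ψ.toV.injective.eq_iff]
      · have := mixed x y x₂ y₂ hk hA₂
        exact iff_of_false this.1 this.2
      · have := mixed x₂ y₂ x y hk₂ hA
        exact iff_of_false this.1.symm this.2.symm
      · obtain ⟨A, hA, hxA, hxb, rfl⟩ := hA
        obtain ⟨A₂, hA₂, hxA₂, hxb₂, rfl⟩ := hA₂
        constructor
        · intro h
          obtain ⟨γ, hγ, rfl⟩ := mk_orbV_eq.1 h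
          obtain ⟨γ', -, hi⟩ := hE.1 γ hγ
          have := S.atom_eq_of_interior hc (hT A₂ hA₂) (hi.isAtom hc (hT A hA)) hxA₂ hxb₂
            ⟨x, hxA, rfl⟩
          obtain ⟨rfl, rfl⟩ := hmap A hA A₂ hA₂ γ hγ this.symm
          rfl
        · intro h
          obtain ⟨δ, hδ, hδy⟩ := mk_orbV_eq.1 h
          obtain ⟨δ', -, hi⟩ := hE'.1 δ hδ
          obtain ⟨h₁, h₂⟩ := hint A₂ hA₂ x₂ hxA₂ hxb₂
          have := S.atom_eq_of_interior hc (M.isAtom hc hA₂ (hT A₂ hA₂))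
            (hi.isAtom hc (M.isAtom hc hA (hT A hA))) h₁ h₂
            ⟨f A x, (M.subIso A hA).bijV.mapsTo hxA, hδy⟩
          obtain ⟨rfl, rfl⟩ := M.eq_of_map_eq hc hE hE' hT hfreeT hfree hA hA₂ hδ this.symm
          rw [(M.subIso A hA).bijV.injOn hxA hxA₂ hδy]
  obtain ⟨eD, heD⟩ : ∃ e : Quotient (orbD Γ) ≃ Quotient (orbD Δ),
      ∀ x y, relD x y → e (Quotient.mk (orbD Γ) x) = Quotient.mk (orbD Δ) y := by
    refine exists_equiv_of_rel _ _ relD ?_ ?_ ?_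
    · intro x
      by_cases hx : KeptD G R x
      · obtain ⟨x', hx'⟩ := S.exists_labelD_kept hx
        obtain ⟨y', hy'⟩ := Quotient.exists_rep (ψ.toD (Quotient.mk (orbD Γ') x'))
        obtain ⟨y, hy⟩ := S.exists_labelD_kept_of_mk ψ hy'.symm hx'
        exact ⟨x, y, rfl, Or.inl ⟨x', y', hx', hy, hy'.symm⟩⟩
      · obtain ⟨A, hA, hxA⟩ := exists_mem_of_not_keptD hx
        obtain ⟨γ, hγ, hγA⟩ := hT' A hA
        exact ⟨γ.toD x, _, mk_orbD_eq.2 ⟨γ, hγ, rfl⟩, Or.inr ⟨_, hγA, ⟨x, hxA, rfl⟩, rfl⟩⟩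
    · intro y
      by_cases hy : KeptD G R y
      · obtain ⟨y', hy'⟩ := S.exists_labelD_kept hy
        obtain ⟨x', hx'⟩ := Quotient.exists_rep (ψ.symm.toD (Quotient.mk (orbD Δ') y'))
        obtain ⟨x, hx⟩ := S.exists_labelD_kept_of_mk ψ.symm hx'.symm hy'
        exact ⟨y, x, rfl, Or.inl ⟨x', y', hx, hy', (Equiv.eq_symm_apply ψ.toD).1 hx'⟩⟩
      · obtain ⟨B, hB, hyB⟩ := exists_mem_of_not_keptD hy
        obtain ⟨A, hA, δ, hδ, hδB⟩ := M.exists_map_eq hc hE hE' hΔ' hT' hB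
        have : δ.toD y ∈ (F A).darts := hδB ▸ ⟨y, hyB, rfl⟩
        obtain ⟨x, hx, hxy⟩ := (M.subIso A hA).bijD.surjOn this
        exact ⟨δ.toD y, x, mk_orbD_eq.2 ⟨δ, hδ, rfl⟩, Or.inr ⟨A, hA, hx, hxy⟩⟩
    · have mixed : ∀ x y x₂ y₂, (∃ x' y', S.labelD x' = Sum.inl x ∧ S.labelD y' = Sum.inl y ∧
            ψ.toD (Quotient.mk (orbD Γ') x') = Quotient.mk (orbD Δ') y') →
          (∃ A ∈ T, x₂ ∈ A.darts ∧ g A x₂ = y₂) →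
          Quotient.mk (orbD Γ) x ≠ Quotient.mk (orbD Γ) x₂ ∧
            Quotient.mk (orbD Δ) y ≠ Quotient.mk (orbD Δ) y₂ := by
        rintro x y x₂ _ ⟨x', y', hx, hy, -⟩ ⟨A, hA, hxA, rfl⟩
        refine ⟨fun h => ?_, fun h => ?_⟩
        · obtain ⟨γ, hγ, rfl⟩ := mk_orbD_eq.1 h
          obtain ⟨γ', -, hi⟩ := hE.1 γ hγ
          exact hi.keptD (S.keptD_of_labelD hx) A (hT A hA) hxA
        · obtain ⟨δ, hδ, hδy⟩ := mk_orbD_eq.1 h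
          obtain ⟨δ', -, hi⟩ := hE'.1 δ hδ
          exact hi.keptD (S.keptD_of_labelD hy) _ (M.isAtom hc hA (hT A hA))
            (hδy ▸ (M.subIso A hA).bijD.mapsTo hxA)
      rintro x y x₂ y₂ (hk | hA) (hk₂ | hA₂)
      · obtain ⟨x', y', hx, hy, hψ⟩ := hk
        obtain ⟨x₂', y₂', hx₂, hy₂, hψ₂⟩ := hk₂
        rw [hE.mk_orbD_eq_iff hx hx₂, hE'.mk_orbD_eq_iff hy hy₂, ← hψ, ← hψ₂,
          ψ.toD.injective.eq_iff]
      · have := mixed x y x₂ y₂ hk hA₂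
        exact iff_of_false this.1 this.2
      · have := mixed x₂ y₂ x y hk₂ hA
        exact iff_of_false this.1.symm this.2.symm
      · obtain ⟨A, hA, hxA, rfl⟩ := hA
        obtain ⟨A₂, hA₂, hxA₂, rfl⟩ := hA₂
        constructor
        · intro h
          obtain ⟨γ, hγ, rfl⟩ := mk_orbD_eq.1 h
          obtain ⟨γ', -, hi⟩ := hE.1 γ hγ
          have := S.atom_eq_of_dart hc hl (hT A₂ hA₂) (hi.isAtom hc (hT A hA)) hxA₂ ⟨x, hxA, rfl⟩
          obtain ⟨rfl, rfl⟩ := hmap A hA A₂ hA₂ γ hγ this.symm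
          rfl
        · intro h
          obtain ⟨δ, hδ, hδy⟩ := mk_orbD_eq.1 h
          obtain ⟨δ', -, hi⟩ := hE'.1 δ hδ
          have := S.atom_eq_of_dart hc hl (M.isAtom hc hA₂ (hT A₂ hA₂))
            (hi.isAtom hc (M.isAtom hc hA (hT A hA))) ((M.subIso A₂ hA₂).bijD.mapsTo hxA₂)
            ⟨g A x, (M.subIso A hA).bijD.mapsTo hxA, hδy⟩
          obtain ⟨rfl, rfl⟩ := M.eq_of_map_eq hc hE hE' hT hfreeT hfree hA hA₂ hδ this.symm
          rw [(M.subIso A hA).bijD.injOn hxA hxA₂ hδy]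
  -- Each orbit contains a related half-edge, so incidence, inversion, colour and kind need checking
  -- on `relD` only.
  have hrep : ∀ q : Quotient (orbD Γ), ∃ d e, Quotient.mk (orbD Γ) d = q ∧ relD d e := by
    intro q
    obtain ⟨d, rfl⟩ := Quotient.exists_rep q
    by_cases hx : KeptD G R d
    · obtain ⟨x', hx'⟩ := S.exists_labelD_kept hx
      obtain ⟨y', hy'⟩ := Quotient.exists_rep (ψ.toD (Quotient.mk (orbD Γ') x'))
      obtain ⟨y, hy⟩ := S.exists_labelD_kept_of_mk ψ hy'.symm hx'
      exact ⟨d, y, rfl, Or.inl ⟨x', y', hx', hy, hy'.symm⟩⟩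
    · obtain ⟨A, hA, hxA⟩ := exists_mem_of_not_keptD hx
      obtain ⟨γ, hγ, hγA⟩ := hT' A hA
      exact ⟨γ.toD d, _, (mk_orbD_eq.2 ⟨γ, hγ, rfl⟩).symm,
        Or.inr ⟨_, hγA, ⟨d, hxA, rfl⟩, rfl⟩⟩
  refine ⟨⟨eV, eD, ?_, ?_, ?_, ?_⟩, ⟨?_, ?_⟩, fun A hA => ⟨fun x hx => heV _ _ (hrelA A hA x hx),
    fun d hd => heD _ _ (Or.inr ⟨A, hA, hd, rfl⟩)⟩⟩
  · intro q
    obtain ⟨d, e, rfl, hr⟩ := hrep q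
    rw [heD d e hr]
    exact (heV _ _ (hsrc d e hr)).symm
  · intro q
    obtain ⟨d, e, rfl, hr⟩ := hrep q
    rw [heD d e hr]
    exact (heD _ _ (hinv d e hr)).symm
  · intro q
    obtain ⟨d, e, rfl, hr⟩ := hrep q
    rw [heD d e hr]
    exact (hcolkind d e hr).1
  · intro q
    obtain ⟨d, e, rfl, hr⟩ := hrep q
    rw [heD d e hr]
    exact (hcolkind d e hr).2
  · exact fun x' y' x y hx hy hψ => heV x y (Or.inl ⟨x', y', hx, hy, hψ⟩)
  · exact fun d' e' d e hd he hψ => heD d e (Or.inl ⟨d', e', hd, he, hψ⟩)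

end Gluing

end Reduction

/-! ### Quotients without half-edges, and the quotient by the trivial group -/

section Quot

variable {V : Type u} {D : Type v} {C : Type w} {G : ColGraph V D C} {Γ Δ : Subgroup (Aut G)}

theorem toD_ne_inv_of_noHalfEdge (h : (quot G Γ).NoHalfEdge) {γ : Aut G} (hγ : γ ∈ Γ) (d : D) :
    γ.toD d ≠ G.inv d :=
  fun h' => h (Quotient.mk _ d) (mk_orbD_eq.2 ⟨γ, hγ, h'⟩).symm

theorem Iso.noHalfEdge {V₁ V₂ : Type u} {D₁ D₂ : Type v} {G₁ : ColGraph V₁ D₁ C}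
    {G₂ : ColGraph V₂ D₂ C} (f : Iso G₁ G₂) (h : G₁.NoHalfEdge) : G₂.NoHalfEdge := by
  intro e he
  obtain ⟨d, rfl⟩ := f.toD.surjective e
  rw [f.inv_map] at he
  exact h d (f.toD.injective he)

theorem semiregular_bot : Semiregular G ⊥ :=
  fun _ hπ hne => absurd (Subgroup.mem_bot.1 hπ) hne

theorem mk_orbV_bot_injective : Function.Injective (Quotient.mk (orbV (⊥ : Subgroup (Aut G)))) := by
  intro x y h
  obtain ⟨π, rfl, hπ⟩ := mk_orbV_eq.1 h
  exact hπ

theorem mk_orbD_bot_injective : Function.Injective (Quotient.mk (orbD (⊥ : Subgroup (Aut G)))) := by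
  intro x y h
  obtain ⟨π, rfl, hπ⟩ := mk_orbD_eq.1 h
  exact hπ

/-- A graph is isomorphic to its quotient by the trivial group. -/
noncomputable def quotBot (G : ColGraph V D C) : Iso G (quot G ⊥) where
  toV := Equiv.ofBijective _ ⟨mk_orbV_bot_injective, Quotient.mk_surjective⟩
  toD := Equiv.ofBijective _ ⟨mk_orbD_bot_injective, Quotient.mk_surjective⟩
  src_map _ := rfl
  inv_map _ := rfl
  color_map _ := rfl
  kind_map _ := rfl

theorem quotBot_symm_mkV (x : V) : (quotBot G).toV.symm (Quotient.mk _ x) = x :=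
  (quotBot G).toV.symm_apply_apply x

theorem quotBot_symm_mkD (d : D) : (quotBot G).toD.symm (Quotient.mk _ d) = d :=
  (quotBot G).toD.symm_apply_apply d

/-- An automorphism, as an isomorphism of the quotients by the trivial group. -/
noncomputable def quotBotMap (π : Aut G) : Iso (quot G ⊥) (quot G ⊥) :=
  ((quotBot G).symm.trans π).trans (quotBot G)

theorem quotBotMap_mkV (π : Aut G) (x : V) :
    (quotBotMap π).toV (Quotient.mk _ x) = Quotient.mk _ (π.toV x) :=
  congrArg (fun y => Quotient.mk (orbV ⊥) (π.toV y)) (quotBot_symm_mkV x)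

theorem quotBotMap_mkD (π : Aut G) (d : D) :
    (quotBotMap π).toD (Quotient.mk _ d) = Quotient.mk _ (π.toD d) :=
  congrArg (fun y => Quotient.mk (orbD ⊥) (π.toD y)) (quotBot_symm_mkD d)

end Quot

/-- `r` picks a base point in each orbit and `p a` carries it to `a`. By freeness this element is
unique, which makes `p` equivariant. -/
theorem exists_equivariant_base {H α : Type*} [Group H] (act : H → α → α)
    (one : ∀ a, act 1 a = a) (mul : ∀ h k a, act (h * k) a = act h (act k a))
    (free : ∀ h a, act h a = a → h = 1) :
    ∃ (r : α → α) (p : α → H), (∀ a, act (p a) (r a) = a) ∧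
      ∀ h a, r (act h a) = r a ∧ p (act h a) = h * p a := by
  let s : Setoid α :=
    { r := fun a b => ∃ h, act h a = b
      iseqv :=
        { refl := fun a => ⟨1, one a⟩
          symm := by
            rintro a _ ⟨h, rfl⟩
            exact ⟨h⁻¹, by rw [← mul, inv_mul_cancel, one]⟩
          trans := by
            rintro a _ _ ⟨h, rfl⟩ ⟨k, rfl⟩
            exact ⟨k * h, mul k h a⟩ } }
  have hp : ∀ a, ∃ h, act h (Quotient.mk s a).out = a := fun a => Quotient.mk_out (s := s) a
  choose p hp using hp
  refine ⟨fun a => (Quotient.mk s a).out, p, hp, fun h a => ?_⟩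
  have hr : Quotient.mk s (act h a) = Quotient.mk s a :=
    (Quotient.sound (show ∃ k, act k a = act h a from ⟨h, rfl⟩)).symm
  refine ⟨congrArg Quotient.out hr, ?_⟩
  have h₁ := hp (act h a)
  rw [hr] at h₁
  have h₂ : act ((h * p a)⁻¹ * p (act h a)) (Quotient.mk s a).out = (Quotient.mk s a).out := by
    rw [mul, h₁]
    conv_lhs => rw [← hp a]
    rw [← mul h, ← mul, hp, inv_mul_cancel, one]
  exact (inv_mul_eq_one.1 (free _ _ h₂)).symm

/-! ### Free action on atoms; uniqueness and existence of an expansion -/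

namespace Reduction

variable {V : Type u} {D : Type v} {C : Type w} {V' : Type u} {D' : Type v}
  {G : ColGraph V D C} {R : Set V} {G' : ColGraph V' D' C}
  {Γ Δ : Subgroup (Aut G)} {Γ' Δ' : Subgroup (Aut G')}

theorem exists_keptV (S : Reduction G R G') (hc : G.simple.Connected) : ∃ x, KeptV G R x := by
  obtain ⟨x⟩ := hc.nonempty
  by_cases hx : KeptV G R x
  · exact ⟨x, hx⟩
  · obtain ⟨A, hA, -⟩ := exists_interior_of_not_keptV hx
    obtain ⟨b, hb⟩ := S.boundary_nonempty hc hA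
    exact ⟨b, S.keptV_of_mem_boundary hA hb⟩

/-- The kernel fixes a common vertex, so the reduction epimorphism is injective on semiregular
groups. -/
theorem eq_one_of_isImage_one (S : Reduction G R G') (hc : G.simple.Connected)
    (hΓ : Semiregular G Γ) {π : Aut G} (hπ : π ∈ Γ) (h : S.IsImage π 1) : π = 1 := by
  obtain ⟨x, hx⟩ := S.exists_keptV hc
  obtain ⟨x', hx'⟩ := S.exists_labelV_kept hx
  by_contra hne
  exact (hΓ π hπ hne).1 x (Sum.inl_injective ((h.labelV_inl hx').symm.trans hx'))

/-- Preserving an atom means fixing or reversing its new edge. Semiregularity handles the first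
case; the second is the half-edge that is excluded. -/
theorem eq_one_of_labelD (S : Reduction G R G') (hc : G.simple.Connected)
    (hΓ' : Semiregular G' Γ') (hN : (quot G' Γ').NoHalfEdge) {π' : Aut G'} (hπ' : π' ∈ Γ')
    {d' : D'} {A : Sub G} {x y : V ⊕ Sub G} (hd : S.labelD d' = Sum.inr (A, x))
    (h : S.labelD (π'.toD d') = Sum.inr (A, y)) : π' = 1 := by
  rcases S.eq_or_eq_inv hc hd h with h | h
  · by_contra hne
    exact (hΓ' π' hπ' hne).2.1 d' h
  · exact absurd h (toD_ne_inv_of_noHalfEdge hN hπ' d')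

theorem Extends.eq_one_of_map_eq {S : Reduction G R G'} (hE : S.Extends Γ Γ')
    (hc : G.simple.Connected) (hΓ : Semiregular G Γ) (hΓ' : Semiregular G' Γ')
    (hN : (quot G' Γ').NoHalfEdge) {A : Sub G} (hA : IsAtom G R A) {π : Aut G} (hπ : π ∈ Γ)
    (h : Sub.map π A = A) : π = 1 := by
  obtain ⟨π', hπ', hi⟩ := hE.1 π hπ
  obtain ⟨b, hb⟩ := S.boundary_nonempty hc hA
  obtain ⟨d', hd⟩ := S.exists_labelD_inl hA hb
  have h' := hi.labelD_inr hd
  rw [h] at h'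
  obtain rfl := S.eq_one_of_labelD hc hΓ' hN hπ' hd h'
  exact S.eq_one_of_isImage_one hc hΓ hπ hi

/-- One half-edge of the new edge is followed through ψ; the isomorphism matched at that end then
fits the other end too. -/
theorem exists_match (S : Reduction G R G') (hc : G.simple.Connected)
    (hΓ' : Semiregular G' Γ') (ψ : Iso (quot G' Γ') (quot G' Δ')) {A : Sub G}
    (hA : IsAtom G R A) :
    ∃ B f g, SubIso A B f g ∧ ∀ d' b, S.labelD d' = Sum.inr (A, Sum.inl b) →
      ∃ e', S.labelD e' = Sum.inr (B, Sum.inl (f b)) ∧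
        ψ.toD (Quotient.mk (orbD Γ') d') = Quotient.mk (orbD Δ') e' := by
  obtain ⟨b, hb⟩ := S.boundary_nonempty hc hA
  obtain ⟨d', hd⟩ := S.exists_labelD_inl hA hb
  obtain ⟨e', he⟩ := Quotient.exists_rep (ψ.toD (Quotient.mk (orbD Γ') d'))
  obtain ⟨B, c, hB⟩ := S.exists_labelD_inl_of_mk hc hΓ' ψ he.symm hd
  obtain ⟨f, g, hfg, rfl⟩ := S.exists_subIso_of_color_eq hc hd hB (ψ.color_eq_of_mk he.symm)
    (ψ.kind_eq_of_mk he.symm)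
  exact ⟨B, f, g, hfg, fun d₂ b₂ hd₂ => S.ends_of_one_end hc ψ hfg hd hB he.symm hd₂⟩

/-- The quotient of the reduced graph determines the quotient of the original graph, if it has no
half-edge with a free end. -/
theorem exists_agree (S : Reduction G R G') (hc : G.simple.Connected)
    (hl : ∀ d, G.src (G.inv d) ≠ G.src d) (hE : S.Extends Γ Γ') (hE' : S.Extends Δ Δ')
    (hΓ : Semiregular G Γ) (hΔ : Semiregular G Δ) (hΓ' : Semiregular G' Γ')
    (hΔ' : Semiregular G' Δ') (hN : (quot G' Γ').NoHalfEdge)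
    (ψ : Iso (quot G' Γ') (quot G' Δ')) : ∃ φ : Iso (quot G Γ) (quot G Δ), S.Agree φ ψ := by
  let s : Setoid (Sub G) :=
    { r := fun A B => ∃ γ ∈ Γ, Sub.map γ A = B
      iseqv :=
        { refl := fun A => ⟨1, Γ.one_mem, Sub.map_one A⟩
          symm := by
            rintro A _ ⟨γ, hγ, rfl⟩
            exact ⟨γ⁻¹, Γ.inv_mem hγ, by rw [← Sub.map_mul, inv_mul_cancel, Sub.map_one]⟩
          trans := by
            rintro A _ _ ⟨γ, hγ, rfl⟩ ⟨δ, hδ, rfl⟩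
            exact ⟨δ * γ, Γ.mul_mem hδ hγ, Sub.map_mul δ γ A⟩ } }
  -- One atom from each Γ-orbit of atoms.
  let T : Set (Sub G) := {A | IsAtom G R A ∧ (Quotient.mk s A).out = A}
  have hmatch : ∀ A, ∃ B f g, IsAtom G R A → SubIso A B f g ∧
      ∀ d' b, S.labelD d' = Sum.inr (A, Sum.inl b) →
        ∃ e', S.labelD e' = Sum.inr (B, Sum.inl (f b)) ∧
          ψ.toD (Quotient.mk (orbD Γ') d') = Quotient.mk (orbD Δ') e' := by
    intro A
    by_cases hA : IsAtom G R A
    · obtain ⟨B, f, g, h⟩ := S.exists_match hc hΓ' ψ hA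
      exact ⟨B, f, g, fun _ => h⟩
    · exact ⟨A, id, id, fun h => absurd h hA⟩
  choose F f g hFfg using hmatch
  have M : S.Matching ψ T F f g :=
    ⟨fun A hA => (hFfg A hA.1).1, fun A hA => (hFfg A hA.1).2⟩
  have hT' : ∀ A, IsAtom G R A → ∃ γ ∈ Γ, Sub.map γ A ∈ T := by
    intro A hA
    have hout : Quotient.mk s (Quotient.mk s A).out = Quotient.mk s A := Quotient.out_eq _
    obtain ⟨γ, hγ, h⟩ := Quotient.exact hout.symm
    obtain ⟨γ', -, hi⟩ := hE.1 γ hγ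
    refine ⟨γ, hγ, hi.isAtom hc hA, ?_⟩
    rw [h, hout]
  have hfreeT : ∀ A ∈ T, ∀ γ ∈ Γ, Sub.map γ A ∈ T → γ = 1 := by
    intro A hA γ hγ hγA
    have : Quotient.mk s A = Quotient.mk s (Sub.map γ A) := Quotient.sound ⟨γ, hγ, rfl⟩
    exact hE.eq_one_of_map_eq hc hΓ hΓ' hN hA.1 hγ (by rw [← hγA.2, ← this, hA.2])
  obtain ⟨φ, hφ, -⟩ := M.exists_iso hc hl hE hE' hΓ' hΔ' (fun A hA => hA.1) hT' hfreeT
    -- Only one quotient is assumed free of half-edges; ψ transfers this to the other.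
    (fun B hB δ hδ h => hE'.eq_one_of_map_eq hc hΔ hΔ' (ψ.noHalfEdge hN) hB hδ h)
  exact ⟨φ, hφ⟩

/-- An automorphism of the reduced graph and isomorphisms of atoms that match it together give an
automorphism of the original graph. -/
theorem exists_lift (S : Reduction G R G') (hc : G.simple.Connected)
    (hl : ∀ d, G.src (G.inv d) ≠ G.src d) (π' : Aut G')
    (F : {A : Sub G // IsAtom G R A} → Sub G) (f : {A : Sub G // IsAtom G R A} → V → V)
    (g : {A : Sub G // IsAtom G R A} → D → D) (hfg : ∀ A, SubIso A.1 (F A) (f A) (g A))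
    (hends : ∀ A d' b, S.labelD d' = Sum.inr (A.1, Sum.inl b) →
      S.labelD (π'.toD d') = Sum.inr (F A, Sum.inl (f A b))) :
    ∃ π, S.IsImage π π' ∧ ∀ A, (∀ x ∈ A.1.verts, π.toV x = f A x) ∧
      ∀ d ∈ A.1.darts, π.toD d = g A d := by
  have hF : ∀ A, Function.extend Subtype.val F id A.1 = F A := Subtype.val_injective.extend_apply F _
  have hf : ∀ A, Function.extend Subtype.val f (fun _ => id) A.1 = f A :=
    Subtype.val_injective.extend_apply f _
  have hg : ∀ A, Function.extend Subtype.val g (fun _ => id) A.1 = g A :=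
    Subtype.val_injective.extend_apply g _
  -- With trivial groups every atom is its own representative. The default values outside the atoms
  -- play no role.
  have M : S.Matching (quotBotMap π') {A | IsAtom G R A} (Function.extend Subtype.val F id)
      (Function.extend Subtype.val f (fun _ => id))
      (Function.extend Subtype.val g (fun _ => id)) := by
    refine ⟨fun A hA => ?_, fun A hA d' b hd => ?_⟩
    · rw [hF ⟨A, hA⟩, hf ⟨A, hA⟩, hg ⟨A, hA⟩]
      exact hfg ⟨A, hA⟩
    · rw [hF ⟨A, hA⟩, hf ⟨A, hA⟩]
      exact ⟨_, hends ⟨A, hA⟩ d' b hd, quotBotMap_mkD π' d'⟩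
  obtain ⟨φ, ⟨hφV, hφD⟩, hφ⟩ := M.exists_iso hc hl S.extends_bot S.extends_bot semiregular_bot
    semiregular_bot (fun A hA => hA)
    (fun A hA => ⟨1, Subgroup.one_mem _, (Sub.map_one A).symm ▸ hA⟩)
    (fun _ _ γ hγ _ => Subgroup.mem_bot.1 hγ) (fun _ _ γ hγ _ => Subgroup.mem_bot.1 hγ)
  obtain ⟨π, hπV, hπD⟩ : ∃ π : Aut G,
      (∀ x y, φ.toV (Quotient.mk _ x) = Quotient.mk _ y → π.toV x = y) ∧
      ∀ d e, φ.toD (Quotient.mk _ d) = Quotient.mk _ e → π.toD d = e := by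
    refine ⟨((quotBot G).trans φ).trans (quotBot G).symm, fun x y h => ?_, fun d e h => ?_⟩
    · exact (congrArg (quotBot G).toV.symm h).trans (quotBot_symm_mkV y)
    · exact (congrArg (quotBot G).toD.symm h).trans (quotBot_symm_mkD e)
  have hfV : ∀ A, ∀ x ∈ A.1.verts, π.toV x = f A x := by
    intro A x hx
    rw [← hf A]
    exact hπV _ _ ((hφ A.1 A.2).1 x hx)
  have hgD : ∀ A, ∀ d ∈ A.1.darts, π.toD d = g A d := by
    intro A d hd
    rw [← hg A]
    exact hπD _ _ ((hφ A.1 A.2).2 d hd)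
  have hmap : ∀ A, Sub.map π A.1 = F A := fun A => Sub.ext
    ((Set.image_congr (hfV A)).trans (hfg A).bijV.image_eq)
    ((Set.image_congr (hgD A)).trans (hfg A).bijD.image_eq)
  -- `hends` speaks of boundary ends only; the half-edge at a pendant vertex is treated as the
  -- opposite one.
  have hpend : ∀ A : {A : Sub G // IsAtom G R A}, ∀ e', S.labelD e' = Sum.inr (A.1, Sum.inr A.1) →
      S.labelD (π'.toD e') = Sum.inr (F A, Sum.inr (F A)) := by
    intro A e' he
    obtain ⟨b, hb⟩ := S.boundary_nonempty hc A.2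
    obtain ⟨d', hd⟩ := S.exists_labelD_inl A.2 hb
    have hde : e' = G'.inv d' := by
      rcases S.eq_or_eq_inv hc hd he with rfl | h
      · rw [hd] at he
        cases he
      · exact h
    have hd₂ := hends A d' b hd
    have hAt := (S.isAtom_of_labelD hd₂).1
    have hFA : IsBlockAtom G R (F A) :=
      (S.isBlockAtom_iff_of_color_eq hc hd hd₂ (π'.color_map d').symm).1
        (S.isBlockAtom_of_labelD he).1
    obtain ⟨-, w, hw, hw'⟩ := S.new_edge _ _ _ hd₂
    rw [hde, ← π'.inv_map, hw']
    rcases (S.isAtom_of_labelD hw').2 with ⟨c, hcb, rfl⟩ | ⟨-, rfl⟩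
    · refine absurd (congrArg Sum.inl ?_) hw
      exact (S.isBlockAtom_iff hAt (S.boundary_nonempty hc hAt)).1 hFA hcb
        (S.mem_boundary_of_labelD hd₂)
    · rfl
  refine ⟨π, ⟨fun x' => ?_, fun d' => ?_⟩, fun A => ⟨hfV A, hgD A⟩⟩
  · rcases hx : S.labelV x' with x | A
    · obtain ⟨y, hy⟩ := S.exists_labelV_kept_of_mk hc S.extends_bot semiregular_bot
        (quotBotMap π') (quotBotMap_mkV π' x') hx
      rw [hy]
      exact congrArg Sum.inl (hπV x y (hφV _ _ x y hx hy (quotBotMap_mkV π' x'))).symm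
    · have hA := S.isBlockAtom_of_labelV hx
      obtain ⟨e', he⟩ := S.exists_labelD hA.1 (Or.inr ⟨hA, rfl⟩)
      obtain rfl : G'.src e' = x' := S.labelV_injective ((S.new_edge e' _ _ he).1.trans hx.symm)
      rw [← π'.src_map, (S.new_edge _ _ _ (hpend ⟨A, hA.1⟩ e' he)).1, ← hmap]
      rfl
  · rcases hd : S.labelD d' with d | ⟨A, b | B⟩
    · obtain ⟨e, he⟩ := S.exists_labelD_kept_of_mk (quotBotMap π') (quotBotMap_mkD π' d') hd
      rw [he]
      exact congrArg Sum.inl (hπD d e (hφD _ _ d e hd he (quotBotMap_mkD π' d'))).symm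
    · have hA := (S.isAtom_of_labelD hd).1
      rw [hends ⟨A, hA⟩ d' b hd, ← hmap, ← hfV _ b (S.mem_boundary_of_labelD hd).1]
      rfl
    · obtain ⟨hA, rfl⟩ := S.isBlockAtom_of_labelD hd
      rw [hpend ⟨B, hA.1⟩ d' hd, ← hmap]
      rfl

/-- Permuting the new edges already makes π' act on the atoms, before any lift of it is known. -/
theorem exists_atom_image (S : Reduction G R G') (hc : G.simple.Connected) (π' : Aut G')
    (A : {A : Sub G // IsAtom G R A}) : ∃ B : {A : Sub G // IsAtom G R A},
      ∀ d' x, S.labelD d' = Sum.inr (A.1, x) →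
        ∃ y, S.labelD (π'.toD d') = Sum.inr (B.1, y) := by
  obtain ⟨b, hb⟩ := S.boundary_nonempty hc A.2
  obtain ⟨d', hd⟩ := S.exists_labelD_inl A.2 hb
  obtain ⟨B, y, hB⟩ := S.exists_labelD_of_color_eq hd (π'.color_map d').symm
  refine ⟨⟨B, (S.isAtom_of_labelD hB).1⟩, fun d₂ x hd₂ => ?_⟩
  rcases S.eq_or_eq_inv hc hd hd₂ with rfl | rfl
  · exact ⟨y, hB⟩
  · obtain ⟨-, z, -, hz⟩ := S.new_edge _ _ _ hB
    exact ⟨z, by rw [← π'.inv_map, hz]⟩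

theorem exists_equiv_match (S : Reduction G R G') (hc : G.simple.Connected) (π' : Aut G')
    {A B : Sub G} (hA : IsAtom G R A)
    (hAB : ∀ d' x, S.labelD d' = Sum.inr (A, x) → ∃ y, S.labelD (π'.toD d') = Sum.inr (B, y)) :
    ∃ f g, SubIso A B f g ∧ ∀ d' b, S.labelD d' = Sum.inr (A, Sum.inl b) →
      S.labelD (π'.toD d') = Sum.inr (B, Sum.inl (f b)) := by
  obtain ⟨E, f, g, hfg, h⟩ := S.exists_match hc semiregular_bot (quotBotMap π') hA
  have h' : ∀ d' b, S.labelD d' = Sum.inr (A, Sum.inl b) →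
      S.labelD (π'.toD d') = Sum.inr (E, Sum.inl (f b)) := by
    intro d' b hd
    obtain ⟨e', he, hmk⟩ := h d' b hd
    rw [quotBotMap_mkD] at hmk
    rwa [mk_orbD_bot_injective hmk]
  obtain ⟨b, hb⟩ := S.boundary_nonempty hc hA
  obtain ⟨d', hd⟩ := S.exists_labelD_inl hA hb
  obtain ⟨y, hy⟩ := hAB d' _ hd
  rw [h' d' b hd] at hy
  obtain rfl : E = B := (Prod.mk.inj (Sum.inr_injective hy)).1
  exact ⟨f, g, hfg, h'⟩

/-- A semiregular group whose quotient has no half-edge with a free end can be extended. -/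
theorem exists_extends (S : Reduction G R G') (hc : G.simple.Connected)
    (hl : ∀ d, G.src (G.inv d) ≠ G.src d) (hΓ' : Semiregular G' Γ')
    (hN : (quot G' Γ').NoHalfEdge) :
    ∃ Γ : Subgroup (Aut G), Semiregular G Γ ∧ S.Extends Γ Γ' := by
  choose act hact using fun π' : Γ' => S.exists_atom_image hc π'.1
  have hbase : ∀ A : {A : Sub G // IsAtom G R A}, ∃ d' x, S.labelD d' = Sum.inr (A.1, x) := by
    intro A
    obtain ⟨b, hb⟩ := S.boundary_nonempty hc A.2
    obtain ⟨d', hd⟩ := S.exists_labelD_inl A.2 hb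
    exact ⟨d', _, hd⟩
  have hactu : ∀ (π' : Γ') A (B : {A : Sub G // IsAtom G R A}) d' x y,
      S.labelD d' = Sum.inr (A.1, x) → S.labelD (π'.1.toD d') = Sum.inr (B.1, y) →
      act π' A = B := by
    intro π' A B d' x y hd hy
    obtain ⟨z, hz⟩ := hact π' A d' x hd
    rw [hy] at hz
    exact Subtype.ext (Prod.mk.inj (Sum.inr_injective hz)).1.symm
  have hone : ∀ A, act 1 A = A := by
    intro A
    obtain ⟨d', x, hd⟩ := hbase A
    exact hactu 1 A A d' x x hd hd
  have hmul : ∀ π' ρ' A, act (π' * ρ') A = act π' (act ρ' A) := by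
    intro π' ρ' A
    obtain ⟨d', x, hd⟩ := hbase A
    obtain ⟨y, hy⟩ := hact ρ' A d' x hd
    obtain ⟨z, hz⟩ := hact π' _ _ y hy
    exact hactu (π' * ρ') A _ d' x z hd hz
  have hfree : ∀ π' A, act π' A = A → π' = 1 := by
    intro π' A h
    obtain ⟨d', x, hd⟩ := hbase A
    obtain ⟨y, hy⟩ := hact π' A d' x hd
    rw [h] at hy
    exact Subtype.ext (S.eq_one_of_labelD hc hΓ' hN π'.2 hd hy)
  obtain ⟨r, p, hp, hrp⟩ := exists_equivariant_base act hone hmul hfree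
  -- Coordinates on A: an isomorphism from the base atom `r A` that lies over `p A` at the ends.
  choose f g hfg hends using fun A : {A : Sub G // IsAtom G R A} =>
    S.exists_equiv_match hc (p A).1 (r A).2 (fun d' x hd => (hp A) ▸ hact (p A) (r A) d' x hd)
  have himage : ∀ {π : Aut G} {π' : Γ'}, S.IsImage π π'.1 →
      ∀ A : {A : Sub G // IsAtom G R A}, Sub.map π A.1 = (act π' A).1 := by
    intro π π' hi A
    obtain ⟨d', x, hd⟩ := hbase A
    exact congrArg Subtype.val (hactu π' A ⟨_, hi.isAtom hc A.2⟩ d' x _ hd (hi.labelD_inr hd)).symm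
  -- Lifts that preserve the coordinates on all atoms; this condition is closed under products and
  -- inverses, and it makes the lift of each element unique.
  let Γ : Subgroup (Aut G) :=
    { carrier := {π | ∃ π' : Γ', S.IsImage π π'.1 ∧ ∀ A,
        (∀ x ∈ (r A).1.verts, π.toV (f A x) = f (act π' A) x) ∧
        ∀ d ∈ (r A).1.darts, π.toD (g A d) = g (act π' A) d}
      one_mem' := ⟨1, S.isImage_one, fun A => by
        rw [hone]
        exact ⟨fun _ _ => rfl, fun _ _ => rfl⟩⟩
      mul_mem' := by
        rintro π ρ ⟨π', hπ, h⟩ ⟨ρ', hρ, k⟩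
        refine ⟨π' * ρ', hπ.mul hρ, fun A => ⟨fun x hx => ?_, fun d hd => ?_⟩⟩
        · rw [hmul, ← (h (act ρ' A)).1 x (by rwa [(hrp ρ' A).1]), ← (k A).1 x hx]
          rfl
        · rw [hmul, ← (h (act ρ' A)).2 d (by rwa [(hrp ρ' A).1]), ← (k A).2 d hd]
          rfl
      inv_mem' := by
        rintro π ⟨π', hπ, h⟩
        refine ⟨π'⁻¹, hπ.inv, fun A => ?_⟩
        have hA : act π' (act π'⁻¹ A) = A := by rw [← hmul, mul_inv_cancel, hone]
        have hA' := h (act π'⁻¹ A)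
        rw [hA, (hrp π'⁻¹ A).1] at hA'
        exact ⟨fun x hx => (Equiv.symm_apply_eq π.toV).2 (hA'.1 x hx).symm,
          fun d hd => (Equiv.symm_apply_eq π.toD).2 (hA'.2 d hd).symm⟩ }
  have hone' : ∀ {π : Aut G}, S.IsImage π 1 → (∀ A,
        (∀ x ∈ (r A).1.verts, π.toV (f A x) = f A x) ∧
        ∀ d ∈ (r A).1.darts, π.toD (g A d) = g A d) → π = 1 := by
    intro π hi h
    refine Iso.ext (Equiv.ext fun x => ?_) (Equiv.ext fun d => ?_)
    · by_cases hx : KeptV G R x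
      · obtain ⟨x', hx'⟩ := S.exists_labelV_kept hx
        exact Sum.inl_injective ((hi.labelV_inl hx').symm.trans hx')
      · obtain ⟨A, hA, hxA, -⟩ := exists_interior_of_not_keptV hx
        obtain ⟨y, hy, rfl⟩ := (hfg ⟨A, hA⟩).bijV.surjOn hxA
        exact (h ⟨A, hA⟩).1 y hy
    · by_cases hx : KeptD G R d
      · obtain ⟨d', hd'⟩ := S.exists_labelD_kept hx
        exact Sum.inl_injective ((hi.labelD_inl hd').symm.trans hd')
      · obtain ⟨A, hA, hdA⟩ := exists_mem_of_not_keptD hx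
        obtain ⟨e, he, rfl⟩ := (hfg ⟨A, hA⟩).bijD.surjOn hdA
        exact (h ⟨A, hA⟩).2 e he
  refine ⟨Γ, ?_, ?_, ?_⟩
  · rintro π ⟨π', hi, h⟩ hne
    have hne' : π' ≠ 1 := by
      rintro rfl
      refine hne (hone' hi fun A => ?_)
      have hA := h A
      rwa [hone] at hA
    have hne'' : π'.1 ≠ 1 := fun h => hne' (Subtype.ext h)
    -- A non-identity element moves every atom off itself, so it fixes nothing inside atoms and
    -- reverses no edge there; on the common part Γ' decides.
    have hmapne : ∀ A, IsAtom G R A → A ≠ Sub.map π A := fun A hA h =>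
      hne' (hfree π' ⟨A, hA⟩ (Subtype.ext ((himage hi ⟨A, hA⟩).symm.trans h.symm)))
    have hdart : ∀ d A, IsAtom G R A → d ∈ A.darts → π.toD d ∉ A.darts := fun d A hA hd h =>
      hmapne A hA (S.atom_eq_of_dart hc hl hA (hi.isAtom hc hA) h ⟨d, hd, rfl⟩)
    refine ⟨fun x hx => ?_, fun d hd => ?_, fun d hd => ?_⟩
    · by_cases hk : KeptV G R x
      · obtain ⟨x', hx'⟩ := S.exists_labelV_kept hk
        have := hi.labelV_inl hx'
        rw [hx, ← hx'] at this
        exact (hΓ' π' π'.2 hne'').1 x' (S.labelV_injective this)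
      · obtain ⟨A, hA, hxA, hxb⟩ := exists_interior_of_not_keptV hk
        exact hmapne A hA
          (S.atom_eq_of_interior hc hA (hi.isAtom hc hA) hxA hxb ⟨x, hxA, hx⟩)
    · by_cases hk : KeptD G R d
      · obtain ⟨d', hd'⟩ := S.exists_labelD_kept hk
        have := hi.labelD_inl hd'
        rw [hd, ← hd'] at this
        exact (hΓ' π' π'.2 hne'').2.1 d' (S.labelD_injective this)
      · obtain ⟨A, hA, hdA⟩ := exists_mem_of_not_keptD hk
        exact hdart d A hA hdA (hd.symm ▸ hdA)
    · by_cases hk : KeptD G R d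
      · obtain ⟨d', hd'⟩ := S.exists_labelD_kept hk
        have := hi.labelD_inl hd'
        rw [hd, ← (S.kept d' d hd').2.1] at this
        exact absurd (S.labelD_injective this) (toD_ne_inv_of_noHalfEdge hN π'.2 d')
      · obtain ⟨A, hA, hdA⟩ := exists_mem_of_not_keptD hk
        exact absurd (hd ▸ A.inv_mem d hdA) (hdart d A hA hdA)
  · rintro π ⟨π', hi, -⟩
    exact ⟨π', π'.2, hi⟩
  · intro π₀ hπ₀
    choose f' g' hfg' hf'f hff' hg'g hgg' using fun A => (hfg A).exists_symm
    -- On A, go back to the base atom and out again to the image of A. This fits π₀ at the ends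
    -- because `p` is equivariant.
    obtain ⟨π, hi, hπ⟩ := S.exists_lift hc hl π₀ (fun A => (act ⟨π₀, hπ₀⟩ A).1)
      (fun A => f (act ⟨π₀, hπ₀⟩ A) ∘ f' A) (fun A => g (act ⟨π₀, hπ₀⟩ A) ∘ g' A)
      (fun A => (hfg' A).comp (by
        have := hfg (act ⟨π₀, hπ₀⟩ A)
        rwa [(hrp ⟨π₀, hπ₀⟩ A).1] at this))
      (by
        intro A d' b hd
        have hb := S.mem_boundary_of_labelD hd
        have hb' := ((hfg' A).boundary b hb.1).2 hb
        obtain ⟨e', he⟩ := S.exists_labelD_inl (r A).2 hb'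
        have h₁ := hends A e' _ he
        rw [hff' A b hb.1, ← hd] at h₁
        have h₂ := hends (act ⟨π₀, hπ₀⟩ A) e' (f' A b) (by rw [(hrp ⟨π₀, hπ₀⟩ A).1, he])
        rw [(hrp ⟨π₀, hπ₀⟩ A).2] at h₂
        rw [← S.labelD_injective h₁]
        exact h₂)
    refine ⟨π, ⟨⟨π₀, hπ₀⟩, hi, fun A => ⟨fun x hx => ?_, fun d hd => ?_⟩⟩, hi⟩
    · rw [(hπ A).1 _ ((hfg A).bijV.mapsTo hx), Function.comp_apply, hf'f A x hx]
    · rw [(hπ A).2 _ ((hfg A).bijD.mapsTo hd), Function.comp_apply, hg'g A d hd]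

end Reduction

/-! ### Connectedness and looplessness of the reduced graph; orders of groups -/

namespace Reduction

variable {V : Type u} {D : Type v} {C : Type w} {V' : Type u} {D' : Type v}
  {G : ColGraph V D C} {R : Set V} {G' : ColGraph V' D' C}

/-- The condition excludes loops and free ends at once, since a half-edge with a free end is its own
opposite. -/
theorem src_inv_ne (S : Reduction G R G') (hl : ∀ d, G.src (G.inv d) ≠ G.src d) (d' : D') :
    G'.src (G'.inv d') ≠ G'.src d' := by
  intro h
  rcases hd : S.labelD d' with d | ⟨A, x⟩
  · obtain ⟨h₁, h₂, -⟩ := S.kept d' d hd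
    have h₃ := (S.kept _ _ h₂).1
    rw [h, h₁] at h₃
    exact hl d (Sum.inl_injective h₃).symm
  · obtain ⟨h₁, y, hy, h₂⟩ := S.new_edge d' A x hd
    have h₃ := (S.new_edge _ _ _ h₂).1
    rw [h, h₁] at h₃
    exact hy h₃.symm

theorem adj_src_inv (S : Reduction G R G') (hl : ∀ d, G.src (G.inv d) ≠ G.src d) (d' : D') :
    G'.simple.Adj (G'.src d') (G'.src (G'.inv d')) :=
  ⟨(S.src_inv_ne hl d').symm, d', rfl, rfl⟩

/-- `x'` is the vertex `z`, or a boundary vertex of the atom that has `z` in its interior. -/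
def Represents (S : Reduction G R G') (z : V) (x' : V') : Prop :=
  S.labelV x' = Sum.inl z ∨
    ∃ A, IsAtom G R A ∧ z ∈ A.verts ∧ z ∉ boundary A ∧ ∃ b ∈ boundary A, S.labelV x' = Sum.inl b

theorem exists_represents (S : Reduction G R G') (hc : G.simple.Connected) (z : V) :
    ∃ x', S.Represents z x' := by
  by_cases hz : KeptV G R z
  · obtain ⟨x', hx'⟩ := S.exists_labelV_kept hz
    exact ⟨x', Or.inl hx'⟩
  · obtain ⟨A, hA, hzA, hzb⟩ := exists_interior_of_not_keptV hz
    obtain ⟨b, hb⟩ := S.boundary_nonempty hc hA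
    obtain ⟨x', hx'⟩ := S.exists_labelV_kept (S.keptV_of_mem_boundary hA hb)
    exact ⟨x', Or.inr ⟨A, hA, hzA, hzb, b, hb, hx'⟩⟩

theorem Represents.exists_boundary {S : Reduction G R G'} {z : V} {x' : V'}
    (h : S.Represents z x') (hc : G.simple.Connected) {A : Sub G} (hA : IsAtom G R A)
    (hz : z ∈ A.verts) : ∃ b ∈ boundary A, S.labelV x' = Sum.inl b := by
  rcases h with h | ⟨B, hB, hzB, hzb, h⟩
  · exact ⟨z, S.keptV_of_labelV h A hA hz, h⟩
  · rwa [← S.atom_eq_of_interior hc hB hA hzB hzb hz]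

theorem Represents.eq_of_keptV {S : Reduction G R G'} {z : V} {x' : V'} (h : S.Represents z x')
    (hz : KeptV G R z) : S.labelV x' = Sum.inl z := by
  rcases h with h | ⟨B, hB, hzB, hzb, -⟩
  · exact h
  · exact absurd (hz B hB hzB) hzb

theorem reachable_of_mem_atom (S : Reduction G R G') (hc : G.simple.Connected)
    (hl : ∀ d, G.src (G.inv d) ≠ G.src d) {A : Sub G} (hA : IsAtom G R A) {z w : V}
    (hz : z ∈ A.verts) (hw : w ∈ A.verts) {x' y' : V'} (hx : S.Represents z x')
    (hy : S.Represents w y') : G'.simple.Reachable x' y' := by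
  obtain ⟨b, hb, hxb⟩ := hx.exists_boundary hc hA hz
  obtain ⟨c, hcb, hyc⟩ := hy.exists_boundary hc hA hw
  obtain ⟨d', hd⟩ := S.exists_labelD_inl hA hb
  obtain ⟨e', he⟩ := S.exists_labelD_inl hA hcb
  obtain rfl := S.labelV_injective ((S.new_edge d' _ _ hd).1.trans hxb.symm)
  obtain rfl := S.labelV_injective ((S.new_edge e' _ _ he).1.trans hyc.symm)
  rcases S.eq_or_eq_inv hc hd he with rfl | rfl
  · rfl
  · exact (S.adj_src_inv hl d').reachable

/-- A walk is pushed down edge by edge: a common edge survives, and an edge within an atom shrinks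
to at most one step along its new edge. -/
theorem reachable_of_represents (S : Reduction G R G') (hc : G.simple.Connected)
    (hl : ∀ d, G.src (G.inv d) ≠ G.src d) {z w : V} (p : G.simple.Walk z w) :
    ∀ x' y', S.Represents z x' → S.Represents w y' → G'.simple.Reachable x' y' := by
  induction p with
  | @nil z =>
    intro x' y' hx hy
    by_cases hz : KeptV G R z
    · rw [S.labelV_injective ((hx.eq_of_keptV hz).trans (hy.eq_of_keptV hz).symm)]
    · obtain ⟨A, hA, hzA, -⟩ := exists_interior_of_not_keptV hz
      exact S.reachable_of_mem_atom hc hl hA hzA hzA hx hy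
  | @cons z t w hadj p ih =>
    intro x' y' hx hy
    obtain ⟨t', ht⟩ := S.exists_represents hc t
    refine SimpleGraph.Reachable.trans ?_ (ih t' y' ht hy)
    obtain ⟨-, d, rfl, rfl⟩ := hadj
    by_cases hd : KeptD G R d
    · obtain ⟨d', hd'⟩ := S.exists_labelD_kept hd
      obtain ⟨h₁, h₂, -⟩ := S.kept d' d hd'
      have h₃ := (S.kept _ _ h₂).1
      obtain rfl := S.labelV_injective (h₁.trans (hx.eq_of_keptV (S.keptV_of_labelV h₁)).symm)
      obtain rfl := S.labelV_injective (h₃.trans (ht.eq_of_keptV (S.keptV_of_labelV h₃)).symm)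
      exact (S.adj_src_inv hl d').reachable
    · obtain ⟨A, hA, hdA⟩ := exists_mem_of_not_keptD hd
      exact S.reachable_of_mem_atom hc hl hA (A.src_mem d hdA) (A.src_mem _ (A.inv_mem d hdA)) hx ht

theorem connected (S : Reduction G R G') (hc : G.simple.Connected)
    (hl : ∀ d, G.src (G.inv d) ≠ G.src d) : G'.simple.Connected := by
  have hrep : ∀ v', ∃ z x', S.Represents z x' ∧ G'.simple.Reachable v' x' := by
    intro v'
    rcases hv : S.labelV v' with z | A
    · exact ⟨z, v', Or.inl hv, SimpleGraph.Reachable.refl v'⟩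
    · have hA := S.isBlockAtom_of_labelV hv
      obtain ⟨e', he⟩ := S.exists_labelD hA.1 (Or.inr ⟨hA, rfl⟩)
      obtain ⟨h₁, y, hy, h₂⟩ := S.new_edge e' _ _ he
      obtain rfl := S.labelV_injective (h₁.trans hv.symm)
      have h₃ := (S.new_edge _ _ _ h₂).1
      rcases (S.isAtom_of_labelD h₂).2 with ⟨b, -, rfl⟩ | ⟨-, h⟩
      · exact ⟨b, _, Or.inl h₃, (S.adj_src_inv hl e').reachable⟩
      · exact absurd h hy
  obtain ⟨z⟩ := hc.nonempty
  obtain ⟨z', -⟩ := S.exists_represents hc z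
  refine (SimpleGraph.connected_iff _).2 ⟨fun v' w' => ?_, ⟨z'⟩⟩
  obtain ⟨z, x', hx, hvx⟩ := hrep v'
  obtain ⟨w, y', hy, hwy⟩ := hrep w'
  obtain ⟨p⟩ := hc.preconnected z w
  exact (hvx.trans (S.reachable_of_represents hc hl p x' y' hx hy)).trans hwy.symm

theorem Extends.natCard_eq {S : Reduction G R G'} {Γ : Subgroup (Aut G)}
    {Γ' : Subgroup (Aut G')} (hE : S.Extends Γ Γ') (hc : G.simple.Connected)
    (hΓ : Semiregular G Γ) : Nat.card Γ = Nat.card Γ' := by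
  choose f hf hi using fun π : Γ => hE.1 π.1 π.2
  refine Nat.card_eq_of_bijective (fun π => (⟨f π, hf π⟩ : Γ')) ⟨fun π ρ h => ?_, fun π' => ?_⟩
  · have h' : f π = f ρ := congrArg Subtype.val h
    have h₁ := (hi π).inv.mul (hi ρ)
    rw [h', inv_mul_cancel] at h₁
    exact Subtype.ext (inv_mul_eq_one.1
      (S.eq_one_of_isImage_one hc hΓ (Γ.mul_mem (Γ.inv_mem π.2) ρ.2) h₁))
  · obtain ⟨π, hπ, h⟩ := hE.2 π'.1 π'.2
    exact ⟨⟨π, hπ⟩, Subtype.ext ((hi ⟨π, hπ⟩).unique h)⟩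

end Reduction

/-- The square of an element that reverses an edge fixes a half-edge, so it is the identity. Odd
order leaves the identity itself, which reverses nothing. -/
theorem Semiregular.noHalfEdge_of_odd {V : Type u} {D : Type v} {C : Type w}
    {G : ColGraph V D C} (hl : ∀ d, G.src (G.inv d) ≠ G.src d) {Γ : Subgroup (Aut G)}
    (hΓ : Semiregular G Γ) (hodd : Odd (Nat.card Γ)) : (quot G Γ).NoHalfEdge := by
  intro q hq
  obtain ⟨d, rfl⟩ := Quotient.exists_rep q
  obtain ⟨γ, hγ, h⟩ := mk_orbD_eq.1 hq.symm
  have hsq : γ ^ 2 = 1 := by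
    by_contra hne
    refine (hΓ _ (Γ.pow_mem hγ 2) hne).2.1 d ?_
    rw [pow_two]
    change γ.toD (γ.toD d) = d
    rw [h, ← γ.inv_map, h, G.inv_inv]
  have h₁ : orderOf (⟨γ, hγ⟩ : Γ) ∣ 2 := orderOf_dvd_of_pow_eq_one (Subtype.ext hsq)
  have h₂ : orderOf (⟨γ, hγ⟩ : Γ) = 1 :=
    Nat.eq_one_of_dvd_coprimes (Nat.coprime_two_left.2 hodd) h₁ (orderOf_dvd_natCard _)
  obtain rfl : γ = 1 := congrArg Subtype.val (orderOf_eq_one_iff.1 h₂)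
  exact hl d (congrArg G.src h.symm)

theorem exists_reverse_sequence {r : ℕ} {M : Fin (r + 1) → Type*}
    (P : ∀ i : Fin r, M i.castSucc → M i.succ → Prop) (a : M (Fin.last r))
    (h : ∀ i b, ∃ c, P i c b) :
    ∃ s : ∀ i, M i, s (Fin.last r) = a ∧ ∀ i : Fin r, P i (s i.castSucc) (s i.succ) := by
  choose c hc using h
  refine ⟨fun i => Fin.reverseInduction a c i, Fin.reverseInduction_last, fun i => ?_⟩
  simp only [Fin.reverseInduction_castSucc]
  exact hc i _

/-! ### The whole reduction series -/

namespace ReductionSeries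

variable {C : Type w} {r : ℕ}

theorem connected_and_src_inv_ne (S : ReductionSeries.{u, v, w} C r) (i : Fin (r + 1)) :
    (S.graph i).simple.Connected ∧
      ∀ d, (S.graph i).src ((S.graph i).inv d) ≠ (S.graph i).src d := by
  induction i using Fin.induction with
  | zero => exact ⟨S.connected, fun d => S.loopless d (S.noHalfEdge d)⟩
  | succ i ih => exact ⟨(S.step i).connected ih.1 ih.2, (S.step i).src_inv_ne ih.2⟩

theorem IsExpansion.odd_natCard {S : ReductionSeries.{u, v, w} C r}
    {Γ : ∀ i, Subgroup (Aut (S.graph i))} (h : S.IsExpansion Γ)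
    (hodd : Odd (Nat.card (Γ (Fin.last r)))) (i : Fin (r + 1)) : Odd (Nat.card (Γ i)) := by
  induction i using Fin.reverseInduction with
  | last => exact hodd
  | cast i ih =>
    rwa [(h.2 i).natCard_eq (S.connected_and_src_inv_ne i.castSucc).1 (h.1 i.castSucc)]

end ReductionSeries

end RegCover

theorem mainTheorem6 {C : Type w} {r : ℕ} (S : RegCover.ReductionSeries.{u, v, w} C r) :
    -- one step: if the quotient of the reduced graph has no half-edge, its expansion is unique
    (∀ (i : Fin r) (Γ' : Subgroup (RegCover.Aut (S.graph i.succ))),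
      RegCover.Semiregular (S.graph i.succ) Γ' →
      (RegCover.quot (S.graph i.succ) Γ').NoHalfEdge →
      (∃ Γ : Subgroup (RegCover.Aut (S.graph i.castSucc)),
        RegCover.Semiregular (S.graph i.castSucc) Γ ∧ (S.step i).Extends Γ Γ') ∧
      ∀ (Δ' : Subgroup (RegCover.Aut (S.graph i.succ)))
        (ψ : RegCover.Iso (RegCover.quot (S.graph i.succ) Γ') (RegCover.quot (S.graph i.succ) Δ'))
        (Γ Δ : Subgroup (RegCover.Aut (S.graph i.castSucc))),
        RegCover.Semiregular (S.graph i.succ) Δ' →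
        RegCover.Semiregular (S.graph i.castSucc) Γ →
        RegCover.Semiregular (S.graph i.castSucc) Δ →
        (S.step i).Extends Γ Γ' → (S.step i).Extends Δ Δ' →
        ∃ φ : RegCover.Iso (RegCover.quot (S.graph i.castSucc) Γ)
            (RegCover.quot (S.graph i.castSucc) Δ),
          (S.step i).Agree φ ψ) ∧
    -- all steps: if the group is of odd order, the last quotient determines all the others
    (∀ Γr : Subgroup (RegCover.Aut (S.graph (Fin.last r))),
      RegCover.Semiregular (S.graph (Fin.last r)) Γr → Odd (Nat.card Γr) →
      (∃ Γ : ∀ i, Subgroup (RegCover.Aut (S.graph i)),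
        S.IsExpansion Γ ∧ Γ (Fin.last r) = Γr) ∧
      ∀ (Γ Δ : ∀ i, Subgroup (RegCover.Aut (S.graph i))), S.IsExpansion Γ → S.IsExpansion Δ →
        Γ (Fin.last r) = Γr →
        ∀ ψ : RegCover.Iso (RegCover.quot (S.graph (Fin.last r)) (Γ (Fin.last r)))
            (RegCover.quot (S.graph (Fin.last r)) (Δ (Fin.last r))),
        ∃ φ : ∀ i, RegCover.Iso (RegCover.quot (S.graph i) (Γ i)) (RegCover.quot (S.graph i) (Δ i)),
          φ (Fin.last r) = ψ ∧
          ∀ i : Fin r, (S.step i).Agree (φ i.castSucc) (φ i.succ)) := by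
  have hinv := S.connected_and_src_inv_ne
  refine ⟨fun i Γ' hΓ' hN => ⟨?_, ?_⟩, fun Γr hΓr hodd => ⟨?_, ?_⟩⟩
  · exact (S.step i).exists_extends (hinv _).1 (hinv _).2 hΓ' hN
  · intro Δ' ψ Γ Δ hΔ' hΓ hΔ hE hE'
    exact (S.step i).exists_agree (hinv _).1 (hinv _).2 hE hE' hΓ hΔ hΓ' hΔ' hN ψ
  -- Odd order is carried along with semiregularity, since it rules out half-edges at the next step.
  · obtain ⟨Γ, hlast, hE⟩ := RegCover.exists_reverse_sequence
      (M := fun i => {Γ : Subgroup (RegCover.Aut (S.graph i)) //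
        RegCover.Semiregular (S.graph i) Γ ∧ Odd (Nat.card Γ)})
      (fun i Γ Γ' => (S.step i).Extends Γ.1 Γ'.1) ⟨Γr, hΓr, hodd⟩ (by
        rintro i ⟨Γ', hΓ', hodd'⟩
        obtain ⟨Γ, hΓ, hE⟩ := (S.step i).exists_extends (hinv _).1 (hinv _).2 hΓ'
          (hΓ'.noHalfEdge_of_odd (hinv _).2 hodd')
        exact ⟨⟨Γ, hΓ, by rwa [hE.natCard_eq (hinv _).1 hΓ]⟩, hE⟩)
    exact ⟨fun i => (Γ i).1, ⟨fun i => (Γ i).2.1, hE⟩, congrArg Subtype.val hlast⟩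
  · rintro Γ Δ hΓ hΔ rfl ψ
    refine RegCover.exists_reverse_sequence
      (M := fun i => RegCover.Iso (RegCover.quot (S.graph i) (Γ i))
        (RegCover.quot (S.graph i) (Δ i)))
      (fun i φ φ' => (S.step i).Agree φ φ') ψ fun i φ' => ?_
    exact (S.step i).exists_agree (hinv _).1 (hinv _).2 (hΓ.2 i) (hΔ.2 i) (hΓ.1 _) (hΔ.1 _)
      (hΓ.1 _) (hΔ.1 _) ((hΓ.1 _).noHalfEdge_of_odd (hinv _).2 (hΓ.odd_natCard hodd _)) φ'
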